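/- **Setting.** Let $d\ge m\ge 1$ be integers, let $\Omega=\Omega^1\times\dots\times\Omega^d$ with each $\Omega^j$ equal to $\mathbb R$ or $\mathbb R_+=[0,\infty)$, with Lebesgue measure, and let $0=l_0<l_1<\dots<l_m=d$ be integers. Write $x=(x_1,\dots,x_d)=(\tilde x_1,\dots,\tilde x_m)$ with $\tilde x_i=(x_{l_{i-1}+1},\dots,x_{l_i})$ and put $\tilde\Omega^i=\Omega^{l_{i-1}+1}\times\dots\times\Omega^{l_i}$. Let $k(1),\dots,k(d)\in\{1,2,\dots\}$ and, for $n\in\mathbb Z$, let $\tilde C^i_n=[0,2^{-nk(l_{i-1}+1)})\times\dots\times[0,2^{-nk(l_i)})$ and $C_n=\tilde C^1_n\times\dots\times\tilde C^m_n$. For $p\in(1,\infty)$, a measurable function $w$ on $\tilde\Omega^i$ with $0<w<\infty$ almost everywhere is an $A_p$-weight, $w\in A_p(\tilde\Omega^i)$, if $$[w]_p=\sup_{C}\Big(\frac1{|C|}\int_C w\,dx\Big)\Big(\frac1{|C|}\int_C w^{-1/(p-1)}\,dx\Big)^{p-1}<\infty ,$$ the supremum being over all translates $C$ of the boxes $\tilde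 C^i_n$, $n\in\mathbb Z$, that are contained in $\tilde\Omega^i$. The class $A_p(\Omega)$ and its $[w]_p$ are defined in the same way with the translates of $C_n$, $n\in\mathbb Z$, that are contained in $\Omega$. The mixed norm is $$\|f\|_{L_{p_1,\dots,p_m}(w^1,\dots,w^m)}=\bigg(\int_{\tilde\Omega^m}\Big(\cdots\Big(\int_{\tilde\Omega^2}\Big(\int_{\tilde\Omega^1}|f|^{p_1}w^1(\tilde x_1)\,d\tilde x_1\Big)^{p_2/p_1}w^2(\tilde x_2)\,d\tilde x_2\Big)^{p_3/p_2}\cdots\Big)^{p_m/p_{m-1}}w^m(\tilde x_m)\,d\tilde x_m\bigg)^{1/p_m},$$ and $\|f\|_{L_p(w\,dx)}=\big(\int_\Omega|f|^pw\,dx\big)^{1/p}$; norms may be infinite. **Theorem.** Let $K_0,p_1,\dots,p_m\in(1,\infty)$. There is a constant $\Lambda_0\ge1$, depending only on $d,p_1,\dots,p_m,k(1),\dots,k(d),K_0$, and for every $N_0\in(0,\infty)$ there is a constant $N\in(0,\infty)$, depending only on the same data and $N_0$, such that the following holds. Let $w^i\in A_{p_i}(\tilde\Omega^i)$ with $[w^i]_{p_i}\le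 K_0$ for $i=1,\dots,m$, and let $u,g$ be real-valued measurable functions on $\Omega$ such that $$\|u\|_{L_{p_1}(w\,dx)}\le N_0\|g\|_{L_{p_1}(w\,dx)}\qquad\text{for every } w\in A_{p_1}(\Omega)\text{ with }[w]_{p_1}\le\Lambda_0 .$$ Then $$\|u\|_{L_{p_1,\dots,p_m}(w^1,\dots,w^m)}\le N\,\|g\|_{L_{p_1,\dots,p_m}(w^1,\dots,w^m)} .$$ In particular $\Lambda_0$ and $N$ do not depend on the choice of the $\Omega^j$ and of the $l_i$. -/

import Mathlib

open MeasureTheory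
open scoped ENNReal

noncomputable section

namespace MixedExtrapolation

/-- The product domain `∏ j, Ω j` inside `ι → ℝ`. -/
def domain {ι : Type*} (Ω : ι → Set ℝ) : Set (ι → ℝ) :=
  Set.univ.pi Ω

/-- The translate by `a` of the anisotropic dyadic box `∏ j, [0, 2 ^ (-n k(j)))`. -/
def box {ι : Type*} (k : ι → ℕ) (n : ℤ) (a : ι → ℝ) : Set (ι → ℝ) :=
  Set.univ.pi fun j => Set.Ico (a j) (a j + (2 : ℝ) ^ (-(n * (k j : ℤ))))

/-- The characteristic `[w]_p` of `w` relative to all translates of the boxes that lie in the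
domain: the supremum of `(⨍ w) * (⨍ w ^ (-1/(p-1))) ^ (p-1)`, as an extended number. -/
def apConst {ι : Type*} [Fintype ι] (Ω : ι → Set ℝ) (k : ι → ℕ) (p : ℝ)
    (w : (ι → ℝ) → ℝ) : ℝ≥0∞ :=
  ⨆ (n : ℤ) (a : ι → ℝ) (_ : box k n a ⊆ domain Ω),
    (⨍⁻ x in box k n a, ENNReal.ofReal (w x) ∂volume) *
      (⨍⁻ x in box k n a, ENNReal.ofReal (w x) ^ (-1 / (p - 1)) ∂volume) ^ (p - 1)

/-- `w` is an `A_p`-weight on the domain: measurable, positive almost everywhere, with finite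
characteristic. (Finiteness forces `w` and `w ^ (-1/(p-1))` to be integrable over every box.)
Only the values of `w` on the domain matter. -/
structure IsApWeight {ι : Type*} [Fintype ι] (Ω : ι → Set ℝ) (k : ι → ℕ) (p : ℝ)
    (w : (ι → ℝ) → ℝ) : Prop where
  aemeasurable : AEMeasurable w (volume.restrict (domain Ω))
  pos : ∀ᵐ x ∂(volume.restrict (domain Ω)), 0 < w x
  finite : apConst Ω k p w < ∞

/-- The norm of `f` in `L_p(w dx)` over the domain, with value `∞` allowed. -/
def weightedNorm {ι : Type*} [Fintype ι] (Ω : ι → Set ℝ) (p : ℝ) (w : (ι → ℝ) → ℝ)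
    (f : (ι → ℝ) → ℝ) : ℝ≥0∞ :=
  (∫⁻ x in domain Ω, ‖f x‖ₑ ^ p * ENNReal.ofReal (w x)) ^ (1 / p)

/-- The `i`-th block of coordinates, for the partition of `{0, …, d-1}` into consecutive intervals
`[l i, l (i+1))`. -/
def block {d m : ℕ} (l : Fin (m + 1) → ℕ) (i : Fin m) : Finset (Fin d) :=
  Finset.univ.filter fun j => l i.castSucc ≤ (j : ℕ) ∧ (j : ℕ) < l i.succ

/-- The mixed norm of `f` over the first `i` blocks of variables, as a function of the remaining
ones: `F 0 = |f|` and
`F (i+1) = (∫ (F i) ^ p i * w i d(variables of block i)) ^ (1 / p i)`. It is written as a function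
of the whole point `x`, and does not depend on the coordinates already integrated out. -/
def partialMixedNorm {d m : ℕ} (Ω : Fin d → Set ℝ) (l : Fin (m + 1) → ℕ) (p : Fin m → ℝ)
    (w : (i : Fin m) → ((block (d := d) l i) → ℝ) → ℝ) (f : (Fin d → ℝ) → ℝ) :
    Fin (m + 1) → (Fin d → ℝ) → ℝ≥0∞ :=
  Fin.induction (motive := fun _ => (Fin d → ℝ) → ℝ≥0∞) (fun x => ‖f x‖ₑ)
    fun i F x =>
      (lmarginal (fun j => (volume : Measure ℝ).restrict (Ω j)) (block l i)
        (fun y => F y ^ p i * ENNReal.ofReal (w i ((block l i).restrict y))) x) ^ (1 / p i)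

/-- The norm of `f` in `L_{p_1,…,p_m}(w^1,…,w^m)`: all blocks are integrated out, so the base
point `0` plays no role. -/
def mixedNorm {d m : ℕ} (Ω : Fin d → Set ℝ) (l : Fin (m + 1) → ℕ) (p : Fin m → ℝ)
    (w : (i : Fin m) → ((block (d := d) l i) → ℝ) → ℝ) (f : (Fin d → ℝ) → ℝ) : ℝ≥0∞ :=
  partialMixedNorm Ω l p w f (Fin.last m) 0

end MixedExtrapolation

end

/-!
The maximal operator over the boxes is bounded on `L_p(W dν)` for `W ∈ A_p`: with
`σ = W ^ (-1 / (p - 1))`, it is dominated by a composition of the maximal operators relative to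
`σ dν` and `W dν`, and these are bounded by the Vitali covering argument because both measures are
doubling. Hence the iteration `∑ b⁻ⁿ Mⁿ f` produces `A_1` majorants of comparable norm, and for such
majorants `F` of `g` and `S` of a test function dual to `u`, the weight `F ^ (1 - r) S` is in
`A_r`. Applying the hypothesis in `L_r` with this weight and using Hölder's inequality gives the
bound in `L_q(W)` for every `W ∈ A_q`: this is extrapolation from `r` to `q`.

For the mixed norm, integrate out one block at a time. Suppose that the norms over the first `i`
blocks, as functions of the remaining coordinates, satisfy the bound in `L_r(V)` for all
`V ∈ A_r`. Extrapolate to the exponent `p i` and use only product weights `w i ⊗ V`, which are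
in `A_{p i}`: by Fubini, this is the same assertion for the first `i + 1` blocks, with `r` replaced
by `p i`.
-/

noncomputable section

namespace MixedExtrapolation

/-! ### Maximal functions over a Vitali basis -/

section LayerCake

variable {X : Type*} [MeasurableSpace X] {μ : Measure X} {f g : X → ℝ≥0∞} {r s : ℝ}

theorem lintegral_Ioi_rpow_eq_top (s : ℝ) :
    ∫⁻ t in Set.Ioi (0 : ℝ), ENNReal.ofReal (t ^ s) = ∞ := by
  by_contra h
  refine not_integrableOn_Ioi_rpow s ((lintegral_ofReal_ne_top_iff_integrable ?_ ?_).1 h)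
  · exact (Measurable.pow_const measurable_id s).aestronglyMeasurable
  · filter_upwards [ae_restrict_mem measurableSet_Ioi] with t ht
    exact Real.rpow_nonneg (le_of_lt ht) s

theorem lintegral_rpow_eq_lintegral_meas_ofReal_lt_mul (hf : AEMeasurable f μ) (hs : 0 < s) :
    ∫⁻ x, f x ^ s ∂μ = ENNReal.ofReal s *
      ∫⁻ t in Set.Ioi (0 : ℝ), μ {x | ENNReal.ofReal t < f x} * ENNReal.ofReal (t ^ (s - 1)) := by
  by_cases h : μ {x | f x = ∞} = 0
  · have hfin : ∀ᵐ x ∂μ, f x ≠ ∞ := by simpa [ae_iff] using h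
    calc ∫⁻ x, f x ^ s ∂μ = ∫⁻ x, ENNReal.ofReal ((f x).toReal ^ s) ∂μ := by
          refine lintegral_congr_ae (hfin.mono fun x hx => ?_)
          beta_reduce
          rw [← ENNReal.ofReal_rpow_of_nonneg ENNReal.toReal_nonneg hs.le, ENNReal.ofReal_toReal hx]
      _ = ENNReal.ofReal s * ∫⁻ t in Set.Ioi (0 : ℝ),
            μ {x | t < (f x).toReal} * ENNReal.ofReal (t ^ (s - 1)) :=
          lintegral_rpow_eq_lintegral_meas_lt_mul μ (.of_forall fun _ => ENNReal.toReal_nonneg)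
            hf.ennreal_toReal hs
      _ = _ := by
          congr 1
          refine setLIntegral_congr_fun measurableSet_Ioi fun t ht => ?_
          congr 1
          exact measure_congr (hfin.mono fun x hx =>
            propext (ENNReal.ofReal_lt_iff_lt_toReal (le_of_lt ht) hx).symm)
  · have hlhs : ∫⁻ x, f x ^ s ∂μ = ∞ := by
      refine lintegral_eq_top_of_measure_eq_top_ne_zero (hf.pow_const s) ?_
      simpa only [ENNReal.rpow_eq_top_iff_of_pos hs] using h
    have hrhs : ∞ ≤ ∫⁻ t in Set.Ioi (0 : ℝ),
        μ {x | ENNReal.ofReal t < f x} * ENNReal.ofReal (t ^ (s - 1)) := by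
      calc ∞ = μ {x | f x = ∞} * ∫⁻ t in Set.Ioi (0 : ℝ), ENNReal.ofReal (t ^ (s - 1)) := by
            rw [lintegral_Ioi_rpow_eq_top, ENNReal.mul_top h]
        _ = ∫⁻ t in Set.Ioi (0 : ℝ), μ {x | f x = ∞} * ENNReal.ofReal (t ^ (s - 1)) := by
            rw [lintegral_const_mul _ (by fun_prop)]
        _ ≤ _ := by
            gcongr with t x
            intro hx
            exact hx ▸ ENNReal.ofReal_lt_top
    rw [hlhs, top_le_iff.1 hrhs, ENNReal.mul_top (by simpa using hs)]

-- A layer cake integral with respect to the measure `f dμ`.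
theorem lintegral_withDensity_lt_two_mul_eq (hf : Measurable f) (hr : 1 < r) :
    ∫⁻ t in Set.Ioi (0 : ℝ), μ.withDensity f {x | ENNReal.ofReal t < 2 * f x} *
        ENNReal.ofReal (t ^ (r - 1 - 1)) =
      2 ^ (r - 1) * (∫⁻ x, f x ^ r ∂μ) / ENNReal.ofReal (r - 1) := by
  have hr1 : 0 < r - 1 := by linarith
  have hsplit : ∀ x, f x * (2 * f x) ^ (r - 1) = 2 ^ (r - 1) * f x ^ r := fun x => by
    rw [ENNReal.mul_rpow_of_nonneg _ _ hr1.le, mul_left_comm]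
    nth_rw 1 [← ENNReal.rpow_one (f x)]
    rw [← ENNReal.rpow_add_of_nonneg _ _ zero_le_one hr1.le, add_sub_cancel]
  rw [ENNReal.eq_div_iff (by simpa using hr1) ENNReal.ofReal_ne_top,
    ← lintegral_rpow_eq_lintegral_meas_ofReal_lt_mul (hf.const_mul 2).aemeasurable hr1,
    lintegral_withDensity_eq_lintegral_mul _ hf ((hf.const_mul 2).pow_const _),
    ← lintegral_const_mul _ (hf.pow_const r)]
  exact lintegral_congr hsplit

/-- The constant of the strong type `(r, r)` estimate that interpolation produces from a weak type
`(1, 1)` estimate with constant one and the trivial bound in `L_∞`. -/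
def strongTypeConst (r : ℝ) : ℝ≥0∞ :=
  ENNReal.ofReal (r / (r - 1)) * 2 ^ r

theorem lintegral_rpow_le_of_weakType (hf : Measurable f) (hg : AEMeasurable g μ) {A : ℝ≥0∞}
    (h : ∀ t, t ≠ 0 → t ≠ ∞ → μ {x | t < g x} ≤ A * (2 / t * μ.withDensity f {x | t < 2 * f x}))
    (hr : 1 < r) :
    ∫⁻ x, g x ^ r ∂μ ≤ A * strongTypeConst r * ∫⁻ x, f x ^ r ∂μ := by
  have hr1 : 0 < r - 1 := by linarith
  set τ := fun t : ℝ => μ.withDensity f {x | ENNReal.ofReal t < 2 * f x}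
  have hτm : Measurable τ :=
    Antitone.measurable fun t t' htt' => measure_mono fun x hx =>
      (ENNReal.ofReal_le_ofReal htt').trans_lt hx
  have hlevel : ∀ t ∈ Set.Ioi (0 : ℝ), μ {x | ENNReal.ofReal t < g x} * ENNReal.ofReal (t ^ (r - 1))
      ≤ A * 2 * (τ t * ENNReal.ofReal (t ^ (r - 1 - 1))) := by
    intro t ht
    have ht0 : ENNReal.ofReal t ≠ 0 := by simpa using ht
    have hpow : ENNReal.ofReal (t ^ (r - 1 - 1)) =
        (ENNReal.ofReal t)⁻¹ * ENNReal.ofReal (t ^ (r - 1)) := by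
      rw [Real.rpow_sub_one (ne_of_gt ht), ENNReal.ofReal_div_of_pos ht, ENNReal.div_eq_inv_mul]
    calc _ ≤ A * (2 / ENNReal.ofReal t * τ t) * ENNReal.ofReal (t ^ (r - 1)) := by
          gcongr
          exact h _ ht0 ENNReal.ofReal_ne_top
      _ = _ := by rw [hpow, div_eq_mul_inv]; ring
  calc ∫⁻ x, g x ^ r ∂μ
      = ENNReal.ofReal r * ∫⁻ t in Set.Ioi (0 : ℝ),
          μ {x | ENNReal.ofReal t < g x} * ENNReal.ofReal (t ^ (r - 1)) :=
        lintegral_rpow_eq_lintegral_meas_ofReal_lt_mul hg (by linarith)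
    _ ≤ ENNReal.ofReal r * ∫⁻ t in Set.Ioi (0 : ℝ),
          A * 2 * (τ t * ENNReal.ofReal (t ^ (r - 1 - 1))) := by
        gcongr ENNReal.ofReal r * ?_
        exact setLIntegral_mono' measurableSet_Ioi hlevel
    _ = A * (ENNReal.ofReal r * (ENNReal.ofReal (r - 1))⁻¹ * (2 * 2 ^ (r - 1))) *
          ∫⁻ x, f x ^ r ∂μ := by
        rw [lintegral_const_mul _ (by fun_prop),
          lintegral_withDensity_lt_two_mul_eq hf hr, div_eq_mul_inv]
        ring
    _ = _ := by
        rw [strongTypeConst, ENNReal.ofReal_div_of_pos hr1, div_eq_mul_inv]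
        congr 3
        nth_rw 1 [← ENNReal.rpow_one 2]
        rw [← ENNReal.rpow_add _ _ two_ne_zero ENNReal.ofNat_ne_top, add_sub_cancel]

end LayerCake

/-- The maximal function over the sets `C i` with respect to the measure `μ`. -/
def maximal {X I : Type*} [MeasurableSpace X] (C : I → Set X) (μ : Measure X) (f : X → ℝ≥0∞)
    (x : X) : ℝ≥0∞ :=
  ⨆ i, (C i).indicator (fun _ => (∫⁻ y in C i, f y ∂μ) / μ (C i)) x

/-- A family of sets to which the Vitali covering lemma applies: a set which meets `carrier j` and
is not much larger, as measured by `size`, lies in the enlargement `carrier (enlarge j)`. The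
enlargement of a set of the family is again in the family, so that `A_p` conditions apply to it. -/
structure VitaliBasis (X I : Type*) [MeasurableSpace X] where
  carrier : I → Set X
  size : I → ℝ
  enlarge : I → I
  measurableSet : ∀ i, MeasurableSet (carrier i)
  nonempty : ∀ i, (carrier i).Nonempty
  size_nonneg : ∀ i, 0 ≤ size i
  subset_enlarge : ∀ i j, (carrier i ∩ carrier j).Nonempty → size i ≤ 3 / 2 * size j →
    carrier i ⊆ carrier (enlarge j)

/-- The measure `μ` is doubling, with constant `A`, with respect to the enlargements of `𝓑`. -/
structure VitaliBasis.IsDoubling {X I : Type*} [MeasurableSpace X] (𝓑 : VitaliBasis X I)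
    (μ : Measure X) (A : ℝ≥0∞) : Prop where
  measure_ne_zero : ∀ i, μ (𝓑.carrier i) ≠ 0
  measure_ne_top : ∀ i, μ (𝓑.carrier i) ≠ ∞
  measure_enlarge_le : ∀ i, μ (𝓑.carrier (𝓑.enlarge i)) ≤ A * μ (𝓑.carrier i)

section Maximal

variable {X I : Type*} [MeasurableSpace X] {μ : Measure X} {A t : ℝ≥0∞} {f φ : X → ℝ≥0∞}
  {C : I → Set X} {𝓑 : VitaliBasis X I}

theorem measurable_maximal [Countable I] (hC : ∀ i, MeasurableSet (C i)) (μ : Measure X)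
    (f : X → ℝ≥0∞) : Measurable (maximal C μ f) :=
  Measurable.iSup fun i => measurable_const.indicator (hC i)

theorem average_le_maximal (μ : Measure X) (f : X → ℝ≥0∞) {i : I} {x : X} (hx : x ∈ C i) :
    (∫⁻ y in C i, f y ∂μ) / μ (C i) ≤ maximal C μ f x := by
  refine le_trans ?_ (le_iSup _ i)
  rw [Set.indicator_of_mem hx]

theorem maximal_le_iff {x : X} :
    maximal C μ f x ≤ t ↔ ∀ i, x ∈ C i → (∫⁻ y in C i, f y ∂μ) / μ (C i) ≤ t := by
  refine iSup_le_iff.trans (forall_congr' fun i => ?_)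
  by_cases hx : x ∈ C i <;> simp [hx]

theorem VitaliBasis.IsDoubling.measure_finset_biUnion_le (h𝓑 : 𝓑.IsDoubling μ A) (s : Finset I)
    (hφ : ∀ i ∈ s, μ (𝓑.carrier i) ≤ ∫⁻ x in 𝓑.carrier i, φ x ∂μ) :
    μ (⋃ i ∈ s, 𝓑.carrier i) ≤ A * ∫⁻ x, φ x ∂μ := by
  classical
  obtain ⟨R, hR⟩ := (s.finite_toSet.image 𝓑.size).bddAbove
  obtain ⟨u, hus, hdisj, hcov⟩ := Vitali.exists_disjoint_subfamily_covering_enlargement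
    𝓑.carrier (s : Set I) 𝓑.size (3 / 2) (by norm_num) (fun i _ => 𝓑.size_nonneg i) R
    (fun i hi => hR (Set.mem_image_of_mem _ hi)) (fun i _ => 𝓑.nonempty i)
  obtain ⟨v, rfl⟩ := (s.finite_toSet.subset hus).exists_finset_coe
  calc μ (⋃ i ∈ s, 𝓑.carrier i) ≤ μ (⋃ i ∈ v, 𝓑.carrier (𝓑.enlarge i)) := by
        refine measure_mono (Set.iUnion₂_subset fun i hi => ?_)
        obtain ⟨j, hj, hne, hsize⟩ := hcov i hi
        exact (𝓑.subset_enlarge i j hne hsize).trans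
          (Set.subset_biUnion_of_mem (u := fun i => 𝓑.carrier (𝓑.enlarge i)) hj)
    _ ≤ ∑ i ∈ v, μ (𝓑.carrier (𝓑.enlarge i)) := measure_biUnion_finset_le _ _
    _ ≤ ∑ i ∈ v, A * ∫⁻ x in 𝓑.carrier i, φ x ∂μ :=
        Finset.sum_le_sum fun i hi => (h𝓑.measure_enlarge_le i).trans
          (by gcongr; exact hφ i (hus hi))
    _ = A * ∫⁻ x in ⋃ i ∈ v, 𝓑.carrier i, φ x ∂μ := by
        rw [← Finset.mul_sum, lintegral_biUnion_finset hdisj fun i _ => 𝓑.measurableSet i]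
    _ ≤ A * ∫⁻ x, φ x ∂μ := by gcongr; exact Measure.restrict_le_self

theorem VitaliBasis.IsDoubling.measure_biUnion_le [Countable I] (h𝓑 : 𝓑.IsDoubling μ A) (s : Set I)
    (hφ : ∀ i ∈ s, μ (𝓑.carrier i) ≤ ∫⁻ x in 𝓑.carrier i, φ x ∂μ) :
    μ (⋃ i ∈ s, 𝓑.carrier i) ≤ A * ∫⁻ x, φ x ∂μ := by
  classical
  rw [Set.biUnion_eq_iUnion, Set.iUnion_eq_iUnion_finset, Directed.measure_iUnion]
  · refine iSup_le fun t => ?_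
    have := h𝓑.measure_finset_biUnion_le (t.image Subtype.val) (φ := φ) fun i hi => by
      obtain ⟨j, -, rfl⟩ := Finset.mem_image.1 hi
      exact hφ j j.2
    rwa [Finset.set_biUnion_finset_image] at this
  · exact directed_of_isDirected_le fun _ _ hsub => Set.biUnion_subset_biUnion_left hsub

-- On a set where the average of `f` exceeds `t`, the part of `f` below `t / 2` contributes at most
-- half of that average.
theorem measure_le_of_lt_average {C : Set X} (h0 : μ C ≠ 0) (htop : μ C ≠ ∞) (hf : Measurable f)
    (ht0 : t ≠ 0) (ht : t ≠ ∞) (h : t < (∫⁻ y in C, f y ∂μ) / μ C) :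
    μ C ≤ ∫⁻ y in C, 2 / t * {x | t < 2 * f x}.indicator f y ∂μ := by
  set E := {x | t < 2 * f x}
  have hE : MeasurableSet E := measurableSet_lt measurable_const (hf.const_mul 2)
  have hsplit : ∀ y, f y ≤ E.indicator f y + t / 2 := by
    intro y
    by_cases hy : y ∈ E
    · rw [Set.indicator_of_mem hy]
      exact le_self_add
    · refine le_add_left ?_
      rw [ENNReal.le_div_iff_mul_le (by simp) (by simp), mul_comm]
      exact not_lt.1 hy
  have hint : t / 2 * μ C + t / 2 * μ C ≤ (∫⁻ y in C, E.indicator f y ∂μ) + t / 2 * μ C := by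
    calc t / 2 * μ C + t / 2 * μ C = t * μ C := by rw [← add_mul, ENNReal.add_halves]
      _ ≤ ∫⁻ y in C, f y ∂μ := (ENNReal.lt_div_iff_mul_lt (.inl h0) (.inl htop)).1 h |>.le
      _ ≤ ∫⁻ y in C, (E.indicator f y + t / 2) ∂μ := lintegral_mono hsplit
      _ = _ := by rw [lintegral_add_right _ measurable_const, setLIntegral_const]
  have hhalf := (ENNReal.add_le_add_iff_right (by finiteness)).1 hint
  rw [lintegral_const_mul _ (hf.indicator hE)]
  calc μ C = 2 / t * (t / 2 * μ C) := by
        rw [← mul_assoc, ← mul_div_assoc, ENNReal.div_mul_cancel ht0 ht,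
          ENNReal.div_self two_ne_zero ENNReal.ofNat_ne_top, one_mul]
    _ ≤ _ := by gcongr

theorem VitaliBasis.IsDoubling.measure_lt_maximal_le [Countable I] (h𝓑 : 𝓑.IsDoubling μ A)
    (hf : Measurable f) (ht0 : t ≠ 0) (ht : t ≠ ∞) :
    μ {x | t < maximal 𝓑.carrier μ f x} ≤
      A * (2 / t * μ.withDensity f {x | t < 2 * f x}) := by
  have hE : MeasurableSet {x | t < 2 * f x} := measurableSet_lt measurable_const (hf.const_mul 2)
  set s : Set I := {i | t < (∫⁻ y in 𝓑.carrier i, f y ∂μ) / μ (𝓑.carrier i)}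
  have hcover : {x | t < maximal 𝓑.carrier μ f x} ⊆ ⋃ i ∈ s, 𝓑.carrier i := by
    intro x hx
    have := mt maximal_le_iff.2 (not_le.2 hx)
    push Not at this
    obtain ⟨i, hxi, hi⟩ := this
    exact Set.mem_biUnion (show i ∈ s from hi) hxi
  rw [withDensity_apply _ hE, ← lintegral_indicator hE, ← lintegral_const_mul _ (hf.indicator hE)]
  exact (measure_mono hcover).trans <| h𝓑.measure_biUnion_le s fun i hi =>
    measure_le_of_lt_average (h𝓑.measure_ne_zero i) (h𝓑.measure_ne_top i) hf ht0 ht hi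

theorem VitaliBasis.IsDoubling.lintegral_maximal_rpow_le [Countable I] (h𝓑 : 𝓑.IsDoubling μ A)
    (hf : Measurable f) {r : ℝ} (hr : 1 < r) :
    ∫⁻ x, maximal 𝓑.carrier μ f x ^ r ∂μ ≤ A * strongTypeConst r * ∫⁻ x, f x ^ r ∂μ :=
  lintegral_rpow_le_of_weakType hf (measurable_maximal 𝓑.measurableSet μ f).aemeasurable
    (fun _ ht0 ht => h𝓑.measure_lt_maximal_le hf ht0 ht) hr

end Maximal

/-! ### Weighted norms and duality -/

/-- A measurable function with values in `(0, ∞)`: a weight in its extended nonnegative form. -/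
structure IsPosWeight {X : Type*} [MeasurableSpace X] (W : X → ℝ≥0∞) : Prop where
  measurable : Measurable W
  ne_zero : ∀ x, W x ≠ 0
  ne_top : ∀ x, W x ≠ ∞

/-- The dual weight `W ^ (-1/(p-1))` of the `A_p` theory, often denoted by `σ`. -/
def dualWeight {X : Type*} (p : ℝ) (W : X → ℝ≥0∞) (x : X) : ℝ≥0∞ :=
  W x ^ (-1 / (p - 1))

theorem dualWeight_eq_rpow {X : Type*} {p q : ℝ} (hpq : p.HolderConjugate q)
    (W : X → ℝ≥0∞) (x : X) :
    dualWeight p W x = W x ^ (1 - q) := by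
  have := hpq.sub_one_ne_zero
  rw [dualWeight]
  congr 1
  field_simp
  linear_combination hpq.mul_eq_add

theorem dualWeight_dualWeight {X : Type*} {p q : ℝ} (hpq : p.HolderConjugate q)
    (W : X → ℝ≥0∞) :
    dualWeight q (dualWeight p W) = W := by
  ext x
  rw [dualWeight_eq_rpow hpq.symm, dualWeight_eq_rpow hpq, ← ENNReal.rpow_mul,
    show (1 - q) * (1 - p) = 1 by linear_combination hpq.mul_eq_add, ENNReal.rpow_one]

/-- The norm of `f` in `L_p(W dν)`. -/
def weightedLpNorm {X : Type*} [MeasurableSpace X] (ν : Measure X) (p : ℝ) (W f : X → ℝ≥0∞) :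
    ℝ≥0∞ :=
  (∫⁻ x, f x ^ p * W x ∂ν) ^ (1 / p)

section Weights

variable {X : Type*} [MeasurableSpace X] {ν : Measure X} {p q r : ℝ} {W V f g : X → ℝ≥0∞}

theorem IsPosWeight.rpow (hW : IsPosWeight W) (s : ℝ) : IsPosWeight fun x => W x ^ s :=
  ⟨hW.measurable.pow_const s, fun x => (ENNReal.rpow_pos (hW.ne_zero x).bot_lt (hW.ne_top x)).ne',
    fun x => ENNReal.rpow_ne_top_of_ne_zero (hW.ne_zero x) (hW.ne_top x)⟩

theorem IsPosWeight.mul (hW : IsPosWeight W) (hV : IsPosWeight V) :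
    IsPosWeight fun x => W x * V x :=
  ⟨hW.measurable.mul hV.measurable, fun x => mul_ne_zero (hW.ne_zero x) (hV.ne_zero x),
    fun x => ENNReal.mul_ne_top (hW.ne_top x) (hV.ne_top x)⟩

theorem IsPosWeight.dual (hW : IsPosWeight W) (p : ℝ) : IsPosWeight (dualWeight p W) :=
  hW.rpow _

theorem IsPosWeight.setLIntegral_ne_zero (hW : IsPosWeight W) {s : Set X} (hs : ν s ≠ 0) :
    ∫⁻ x in s, W x ∂ν ≠ 0 := by
  rw [← pos_iff_ne_zero, setLIntegral_pos_iff hW.measurable]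
  have : Function.support W = Set.univ := Set.eq_univ_of_forall hW.ne_zero
  simpa [this, pos_iff_ne_zero] using hs

theorem setLIntegral_div_withDensity (hW : IsPosWeight W) (hf : Measurable f) {s : Set X}
    (hs : MeasurableSet s) : ∫⁻ x in s, f x / W x ∂ν.withDensity W = ∫⁻ x in s, f x ∂ν := by
  refine (setLIntegral_withDensity_eq_setLIntegral_mul _ hW.measurable
    (hf.div hW.measurable) hs).trans ?_
  exact lintegral_congr fun x => ENNReal.mul_div_cancel (hW.ne_zero x) (hW.ne_top x)

theorem lintegral_div_rpow_withDensity (hpq : p.HolderConjugate q) (hW : IsPosWeight W)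
    (hf : Measurable f) :
    ∫⁻ x, (f x / W x) ^ q ∂ν.withDensity W = ∫⁻ x, f x ^ q * dualWeight p W x ∂ν := by
  refine (lintegral_withDensity_eq_lintegral_mul _ hW.measurable
    ((hf.div hW.measurable).pow_const q)).trans (lintegral_congr fun x => ?_)
  rw [Pi.mul_apply, Pi.div_apply, ENNReal.div_rpow_of_nonneg _ _ hpq.symm.nonneg,
    dualWeight_eq_rpow hpq, ENNReal.rpow_sub _ _ (hW.ne_zero x) (hW.ne_top x), ENNReal.rpow_one,
    div_eq_mul_inv, div_eq_mul_inv, mul_left_comm]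

theorem weightedLpNorm_rpow (hp : 0 < p) (f : X → ℝ≥0∞) :
    weightedLpNorm ν p W f ^ p = ∫⁻ x, f x ^ p * W x ∂ν := by
  rw [weightedLpNorm, ← ENNReal.rpow_mul, one_div_mul_cancel hp.ne', ENNReal.rpow_one]

theorem weightedLpNorm_le_iff (hp : 0 < p) {a : ℝ≥0∞} :
    weightedLpNorm ν p W f ≤ a ↔ ∫⁻ x, f x ^ p * W x ∂ν ≤ a ^ p := by
  rw [← weightedLpNorm_rpow hp, ENNReal.rpow_le_rpow_iff hp]

theorem weightedLpNorm_mono_ae (hp : 0 < p) (h : f ≤ᵐ[ν] g) :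
    weightedLpNorm ν p W f ≤ weightedLpNorm ν p W g := by
  refine ENNReal.rpow_le_rpow (lintegral_mono_ae (h.mono fun x hx => ?_)) (by positivity)
  gcongr

theorem weightedLpNorm_eq_lintegral_mul_rpow (hp : 0 < p) (f : X → ℝ≥0∞) :
    weightedLpNorm ν p W f = (∫⁻ x, (f x * W x ^ (1 / p)) ^ p ∂ν) ^ (1 / p) := by
  simp only [weightedLpNorm, ENNReal.mul_rpow_of_nonneg _ _ hp.le, ← ENNReal.rpow_mul,
    one_div_mul_cancel hp.ne', ENNReal.rpow_one]

theorem weightedLpNorm_const_mul (hp : 0 < p) (hW : Measurable W) (hf : Measurable f)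
    (c : ℝ≥0∞) : weightedLpNorm ν p W (fun x => c * f x) = c * weightedLpNorm ν p W f := by
  simp_rw [weightedLpNorm, ENNReal.mul_rpow_of_nonneg _ _ hp.le, mul_assoc]
  rw [lintegral_const_mul _ (by fun_prop), ENNReal.mul_rpow_of_nonneg _ _ (by positivity),
    ← ENNReal.rpow_mul, mul_one_div_cancel hp.ne', ENNReal.rpow_one]

theorem weightedLpNorm_add_le (hp : 1 ≤ p) (hW : Measurable W) (hf : Measurable f)
    (hg : Measurable g) :
    weightedLpNorm ν p W (fun x => f x + g x) ≤
      weightedLpNorm ν p W f + weightedLpNorm ν p W g := by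
  have hp0 : 0 < p := by linarith
  simp_rw [weightedLpNorm_eq_lintegral_mul_rpow hp0, add_mul]
  exact ENNReal.lintegral_Lp_add_le (hf.mul (hW.pow_const _)).aemeasurable
    (hg.mul (hW.pow_const _)).aemeasurable hp

theorem weightedLpNorm_sum_le (hp : 1 ≤ p) (hW : Measurable W) {f : ℕ → X → ℝ≥0∞}
    (hf : ∀ n, Measurable (f n)) (n : ℕ) :
    weightedLpNorm ν p W (fun x => ∑ k ∈ Finset.range n, f k x) ≤
      ∑ k ∈ Finset.range n, weightedLpNorm ν p W (f k) := by
  induction n with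
  | zero => simp [weightedLpNorm, show 0 < p by linarith]
  | succ n ih =>
    simp_rw [Finset.sum_range_succ]
    exact (weightedLpNorm_add_le hp hW (Finset.measurable_sum _ fun k _ => hf k) (hf n)).trans
      (by gcongr)

theorem weightedLpNorm_tsum_le (hp : 1 ≤ p) (hW : Measurable W) {f : ℕ → X → ℝ≥0∞}
    (hf : ∀ n, Measurable (f n)) :
    weightedLpNorm ν p W (fun x => ∑' n, f n x) ≤ ∑' n, weightedLpNorm ν p W (f n) := by
  have hp0 : 0 < p := by linarith
  have hiSup : ∀ x, (∑' n, f n x) ^ p * W x =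
      ⨆ n : ℕ, (∑ k ∈ Finset.range n, f k x) ^ p * W x := fun x => by
    rw [ENNReal.tsum_eq_iSup_nat, ← ENNReal.iSup_mul]
    congr 1
    exact (ENNReal.orderIsoRpow p hp0).map_iSup _
  rw [weightedLpNorm_le_iff hp0]
  simp_rw [hiSup]
  rw [lintegral_iSup fun n => by fun_prop]
  · refine iSup_le fun n => (weightedLpNorm_le_iff hp0).1 ?_
    exact (weightedLpNorm_sum_le hp hW hf n).trans (ENNReal.sum_le_tsum _)
  · intro n m hnm x
    dsimp only
    gcongr

theorem lintegral_mul_le_weightedLpNorm_mul (hpq : p.HolderConjugate q) (hW : IsPosWeight W)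
    (hf : AEMeasurable f ν) (hg : AEMeasurable g ν) :
    ∫⁻ x, f x * g x ∂ν ≤ weightedLpNorm ν p W f * weightedLpNorm ν q (dualWeight p W) g := by
  have hcancel : ∀ x, W x ^ (1 / p) * dualWeight p W x ^ (1 / q) = 1 := fun x => by
    have := hpq.ne_zero
    have := hpq.symm.ne_zero
    rw [dualWeight_eq_rpow hpq, ← ENNReal.rpow_mul,
      ← ENNReal.rpow_add _ _ (hW.ne_zero x) (hW.ne_top x),
      show 1 / p + (1 - q) * (1 / q) = 0 by field_simp; linear_combination -hpq.mul_eq_add,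
      ENNReal.rpow_zero]
  rw [weightedLpNorm_eq_lintegral_mul_rpow hpq.pos,
    weightedLpNorm_eq_lintegral_mul_rpow hpq.symm.pos]
  refine le_of_eq_of_le (lintegral_congr fun x => ?_) (ENNReal.lintegral_mul_le_Lp_mul_Lq ν hpq
    (hf.mul (hW.measurable.pow_const _).aemeasurable)
    (hg.mul ((hW.dual p).measurable.pow_const _).aemeasurable))
  rw [Pi.mul_apply, mul_mul_mul_comm, hcancel, mul_one]

theorem ae_ne_top_of_weightedLpNorm_ne_top (hp : 0 < p) (hW : IsPosWeight W) (hf : Measurable f)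
    (h : weightedLpNorm ν p W f ≠ ∞) : ∀ᵐ x ∂ν, f x ≠ ∞ := by
  have hint : ∫⁻ x, f x ^ p * W x ∂ν ≠ ∞ := by
    rw [← weightedLpNorm_rpow hp]
    exact ENNReal.rpow_ne_top_of_nonneg hp.le h
  filter_upwards [ae_lt_top ((hf.pow_const p).mul hW.measurable) hint] with x hx hfx
  simp [hfx, hp, hW.ne_zero x] at hx

theorem exists_pos_weightedLpNorm_le [SigmaFinite ν] (hp : 0 < p) (hW : IsPosWeight W) {ε : ℝ≥0∞}
    (hε : ε ≠ 0) :
    ∃ φ : X → ℝ≥0∞, Measurable φ ∧ (∀ x, φ x ≠ 0) ∧ weightedLpNorm ν p W φ ≤ ε := by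
  have : SigmaFinite (ν.withDensity W) := .withDensity_of_ne_top (.of_forall hW.ne_top)
  obtain ⟨φ, hφ0, hφm, hφ⟩ := exists_pos_lintegral_lt_of_sigmaFinite (ν.withDensity W)
    (ε := ε ^ p) (by simpa [hp, hp.le] using hε)
  refine ⟨fun x => (φ x : ℝ≥0∞) ^ (1 / p), hφm.coe_nnreal_ennreal.pow_const _, fun x => ?_, ?_⟩
  · simpa [hp] using (hφ0 x).ne'
  · rw [weightedLpNorm_le_iff hp]
    simp_rw [← ENNReal.rpow_mul, one_div_mul_cancel hp.ne', ENNReal.rpow_one]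
    rw [lintegral_withDensity_eq_lintegral_mul _ hW.measurable hφm.coe_nnreal_ennreal] at hφ
    simpa only [Pi.mul_apply, mul_comm] using hφ.le

end Weights

/-! ### Muckenhoupt weights and the maximal theorem -/

/-- The `A_p` condition for `W` on the sets `C i`, with constant `K` and cleared denominators. -/
def HasAp {X I : Type*} [MeasurableSpace X] (C : I → Set X) (ν : Measure X) (p : ℝ)
    (W : X → ℝ≥0∞) (K : ℝ≥0∞) : Prop :=
  ∀ i, (∫⁻ x in C i, W x ∂ν) * (∫⁻ x in C i, dualWeight p W x ∂ν) ^ (p - 1) ≤ K * ν (C i) ^ p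

section Muckenhoupt

variable {X I : Type*} [MeasurableSpace X] {ν : Measure X} {D K : ℝ≥0∞} {C : I → Set X} {p q : ℝ}
  {W f : X → ℝ≥0∞} {𝓑 : VitaliBasis X I}

theorem HasAp.dual (hpq : p.HolderConjugate q) (h : HasAp C ν p W K) :
    HasAp C ν q (dualWeight p W) (K ^ (q - 1)) := by
  intro i
  rw [dualWeight_dualWeight hpq]
  have hq1 := hpq.symm.sub_one_pos
  have := ENNReal.rpow_le_rpow (h i) hq1.le
  rwa [ENNReal.mul_rpow_of_nonneg _ _ hq1.le, ENNReal.mul_rpow_of_nonneg _ _ hq1.le,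
    ← ENNReal.rpow_mul, ← ENNReal.rpow_mul,
    show (p - 1) * (q - 1) = 1 by linear_combination hpq.mul_eq_add,
    show p * (q - 1) = q by linear_combination hpq.mul_eq_add, ENNReal.rpow_one, mul_comm] at this

theorem HasAp.setLIntegral_ne_top (hp : 1 < p) (hW : IsPosWeight W) (hK : K ≠ ∞)
    (h : HasAp C ν p W K) {i : I} (h0 : ν (C i) ≠ 0) (ht : ν (C i) ≠ ∞) :
    ∫⁻ x in C i, W x ∂ν ≠ ∞ := by
  have hp1 : 0 < p - 1 := by linarith
  intro htop
  have hi := h i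
  rw [htop, ENNReal.top_mul, top_le_iff] at hi
  · have : 0 ≤ p := by linarith
    exact absurd hi (by finiteness)
  · rw [Ne, ENNReal.rpow_eq_zero_iff_of_pos hp1]
    exact (hW.dual p).setLIntegral_ne_zero h0

theorem measure_rpow_le_setLIntegral_mul (hpq : p.HolderConjugate q) (hW : IsPosWeight W)
    (s : Set X) :
    ν s ^ p ≤ (∫⁻ x in s, W x ∂ν) * (∫⁻ x in s, dualWeight p W x ∂ν) ^ (p - 1) := by
  have h := ENNReal.rpow_le_rpow (lintegral_mul_le_weightedLpNorm_mul (ν := ν.restrict s) hpq hW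
    (f := 1) (g := 1) aemeasurable_const aemeasurable_const) hpq.nonneg
  rw [ENNReal.mul_rpow_of_nonneg _ _ hpq.nonneg, weightedLpNorm_rpow hpq.pos, weightedLpNorm,
    ← ENNReal.rpow_mul, one_div_mul_eq_div, hpq.div_conj_eq_sub_one] at h
  simpa using h

theorem HasAp.setLIntegral_enlarge_le (hpq : p.HolderConjugate q) (h𝓑 : 𝓑.IsDoubling ν D)
    (hW : IsPosWeight W) (hK : K ≠ ∞) (h : HasAp 𝓑.carrier ν p W K) (i : I) :
    ∫⁻ x in 𝓑.carrier (𝓑.enlarge i), W x ∂ν ≤ K * D ^ p * ∫⁻ x in 𝓑.carrier i, W x ∂ν := by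
  have hp1 := hpq.sub_one_pos
  have hp0 := hpq.pos
  set j := 𝓑.enlarge i
  set w := fun i => ∫⁻ x in 𝓑.carrier i, W x ∂ν
  set σ := fun i => ∫⁻ x in 𝓑.carrier i, dualWeight p W x ∂ν
  have hσ0 : σ j ≠ 0 := (hW.dual p).setLIntegral_ne_zero (h𝓑.measure_ne_zero j)
  have hσt : σ j ≠ ∞ := (h.dual hpq).setLIntegral_ne_top hpq.symm.lt (hW.dual p)
    (ENNReal.rpow_ne_top_of_nonneg hpq.symm.sub_one_pos.le hK)
    (h𝓑.measure_ne_zero j) (h𝓑.measure_ne_top j)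
  have hσij : σ i ≤ σ j := by
    refine lintegral_mono_set (𝓑.subset_enlarge i i (by simpa using 𝓑.nonempty i) ?_)
    linarith [𝓑.size_nonneg i]
  have hkey : w j * σ j ^ (p - 1) ≤ K * D ^ p * w i * σ j ^ (p - 1) := by
    calc w j * σ j ^ (p - 1) ≤ K * ν (𝓑.carrier j) ^ p := h j
      _ ≤ K * (D * ν (𝓑.carrier i)) ^ p := by gcongr; exact h𝓑.measure_enlarge_le i
      _ = K * D ^ p * ν (𝓑.carrier i) ^ p := by
          rw [ENNReal.mul_rpow_of_nonneg _ _ hp0.le, mul_assoc]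
      _ ≤ K * D ^ p * (w i * σ i ^ (p - 1)) := by
          gcongr
          exact measure_rpow_le_setLIntegral_mul hpq hW _
      _ ≤ K * D ^ p * w i * σ j ^ (p - 1) := by rw [mul_assoc _ (w i)]; gcongr
  exact (ENNReal.mul_le_mul_iff_left (by rwa [Ne, ENNReal.rpow_eq_zero_iff_of_pos hp1])
    (ENNReal.rpow_ne_top_of_nonneg hp1.le hσt)).1 hkey

theorem HasAp.isDoubling (hpq : p.HolderConjugate q) (h𝓑 : 𝓑.IsDoubling ν D) (hW : IsPosWeight W)
    (hK : K ≠ ∞) (h : HasAp 𝓑.carrier ν p W K) :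
    𝓑.IsDoubling (ν.withDensity W) (K * D ^ p) where
  measure_ne_zero i := by
    rw [withDensity_apply _ (𝓑.measurableSet i)]
    exact hW.setLIntegral_ne_zero (h𝓑.measure_ne_zero i)
  measure_ne_top i := by
    rw [withDensity_apply _ (𝓑.measurableSet i)]
    exact h.setLIntegral_ne_top hpq.lt hW hK (h𝓑.measure_ne_zero i) (h𝓑.measure_ne_top i)
  measure_enlarge_le i := by
    rw [withDensity_apply _ (𝓑.measurableSet _), withDensity_apply _ (𝓑.measurableSet i)]
    exact h.setLIntegral_enlarge_le hpq h𝓑 hW hK i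

-- With `v`, `w`, `s` the integrals over a set `C` of `1`, `W` and the dual weight, this rewrites an
-- average with respect to `ν` as averages with respect to the two weighted measures.
theorem div_rpow_le_of_mul_rpow_le {F v w s K : ℝ≥0∞} (hp : 1 < p) (hv0 : v ≠ 0) (hv : v ≠ ∞)
    (hw0 : w ≠ 0) (hw : w ≠ ∞) (hs0 : s ≠ 0) (hs : s ≠ ∞) (h : w * s ^ (p - 1) ≤ K * v ^ p) :
    (F / v) ^ (p - 1) ≤ K * ((F / s) ^ (p - 1) * v / w) := by
  have hp0 : 0 < p := by linarith
  have hp1 : 0 < p - 1 := by linarith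
  have hvp : v ^ (p - 1) * v = v ^ p := by
    nth_rw 2 [← ENNReal.rpow_one v]
    rw [← ENNReal.rpow_add _ _ hv0 hv, sub_add_cancel]
  have hF : F ^ (p - 1) = (F / s) ^ (p - 1) * s ^ (p - 1) := by
    rw [← ENNReal.mul_rpow_of_nonneg _ _ hp1.le, ENNReal.div_mul_cancel hs0 hs]
  rw [← ENNReal.mul_le_mul_iff_left (c := v ^ p * w) (mul_ne_zero
    (by rwa [Ne, ENNReal.rpow_eq_zero_iff_of_pos hp0]) hw0) (by finiteness)]
  calc (F / v) ^ (p - 1) * (v ^ p * w)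
      = F ^ (p - 1) * v * w := by
        rw [← hvp, ← mul_assoc, ← mul_assoc, ← ENNReal.mul_rpow_of_nonneg _ _ hp1.le,
          ENNReal.div_mul_cancel hv0 hv]
    _ = (F / s) ^ (p - 1) * v * (w * s ^ (p - 1)) := by
        rw [hF]
        ring
    _ ≤ (F / s) ^ (p - 1) * v * (K * v ^ p) := by gcongr
    _ = K * ((F / s) ^ (p - 1) * v / w * w) * v ^ p := by
        rw [ENNReal.div_mul_cancel hw0 hw]
        ring
    _ = _ := by ring

theorem HasAp.maximal_rpow_le (hpq : p.HolderConjugate q) (h𝓑 : 𝓑.IsDoubling ν D) [Countable I]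
    (hW : IsPosWeight W) (hK : K ≠ ∞) (h : HasAp 𝓑.carrier ν p W K) (hf : Measurable f) (x : X) :
    maximal 𝓑.carrier ν f x ^ (p - 1) ≤ K * maximal 𝓑.carrier (ν.withDensity W)
      (fun y => maximal 𝓑.carrier (ν.withDensity (dualWeight p W))
        (fun z => f z / dualWeight p W z) y ^ (p - 1) / W y) x := by
  have hp1 := hpq.sub_one_pos
  set σ := dualWeight p W
  have hσ : IsPosWeight σ := hW.dual p
  set m := maximal 𝓑.carrier (ν.withDensity σ) (fun z => f z / σ z)
  have hm : Measurable m := measurable_maximal 𝓑.measurableSet _ _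
  have hWd := h.isDoubling hpq h𝓑 hW hK
  have hσd := (h.dual hpq).isDoubling hpq.symm h𝓑 hσ
    (ENNReal.rpow_ne_top_of_nonneg hpq.symm.sub_one_pos.le hK)
  rw [← ENNReal.le_rpow_inv_iff hp1, maximal_le_iff]
  intro i hx
  rw [ENNReal.le_rpow_inv_iff hp1]
  set C := 𝓑.carrier i
  have hC : MeasurableSet C := 𝓑.measurableSet i
  set F := ∫⁻ y in C, f y ∂ν
  have hm_ge : ∀ y ∈ C, F / ν.withDensity σ C ≤ m y := fun y hy => by
    have := average_le_maximal (ν.withDensity σ) (fun z => f z / σ z) hy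
    rwa [setLIntegral_div_withDensity hσ hf hC] at this
  calc (F / ν C) ^ (p - 1)
      ≤ K * ((F / ν.withDensity σ C) ^ (p - 1) * ν C / ν.withDensity W C) := by
        refine div_rpow_le_of_mul_rpow_le hpq.lt (h𝓑.measure_ne_zero i) (h𝓑.measure_ne_top i)
          (hWd.measure_ne_zero i) (hWd.measure_ne_top i) (hσd.measure_ne_zero i)
          (hσd.measure_ne_top i) ?_
        rw [withDensity_apply _ hC, withDensity_apply _ hC]
        exact h i
    _ ≤ K * ((∫⁻ y in C, m y ^ (p - 1) ∂ν) / ν.withDensity W C) := by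
        gcongr
        rw [← setLIntegral_const]
        exact setLIntegral_mono' hC fun y hy => ENNReal.rpow_le_rpow (hm_ge y hy) hp1.le
    _ ≤ _ := by
        gcongr
        have := average_le_maximal (ν.withDensity W) (fun y => m y ^ (p - 1) / W y) hx
        rwa [setLIntegral_div_withDensity hW (hm.pow_const _) hC] at this

/-- The bound of the maximal operator on `L_p(W)`, for a weight with `A_p` constant `K` and a basis
with doubling constant `D`, that results from two applications of the maximal theorem: on
`L_q(W dν)` with `q` the conjugate exponent, and on `L_p(σ dν)` with `σ` the dual weight. -/
def muckenhouptConst (p : ℝ) (D K : ℝ≥0∞) : ℝ≥0∞ :=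
  K ^ p.conjExponent * (K * D ^ p * strongTypeConst p.conjExponent *
    (K ^ (p.conjExponent - 1) * D ^ p.conjExponent * strongTypeConst p))

theorem muckenhouptConst_ne_top (hp : 1 < p) (hD : D ≠ ∞) (hK : K ≠ ∞) :
    muckenhouptConst p D K ≠ ∞ := by
  have hpq := Real.HolderConjugate.conjExponent hp
  have hp0 := hpq.nonneg
  have hq0 := hpq.symm.nonneg
  have hq1 := hpq.symm.sub_one_pos.le
  unfold muckenhouptConst strongTypeConst
  finiteness

theorem HasAp.lintegral_maximal_div_rpow_le [Countable I] (hpq : p.HolderConjugate q)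
    (h𝓑 : 𝓑.IsDoubling ν D) (hW : IsPosWeight W) (hK : K ≠ ∞) (h : HasAp 𝓑.carrier ν p W K)
    (hf : Measurable f) :
    ∫⁻ x, maximal 𝓑.carrier (ν.withDensity W) (fun y => f y / W y) x ^ q ∂ν.withDensity W ≤
      K * D ^ p * strongTypeConst q * ∫⁻ x, f x ^ q * dualWeight p W x ∂ν :=
  ((h.isDoubling hpq h𝓑 hW hK).lintegral_maximal_rpow_le (hf.div hW.measurable)
    hpq.symm.lt).trans_eq (by rw [← lintegral_div_rpow_withDensity hpq hW hf]; rfl)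

theorem HasAp.lintegral_maximal_rpow_mul_le [Countable I] (h𝓑 : 𝓑.IsDoubling ν D) (hp : 1 < p)
    (hW : IsPosWeight W) (hK : K ≠ ∞) (h : HasAp 𝓑.carrier ν p W K) (hf : Measurable f) :
    ∫⁻ x, maximal 𝓑.carrier ν f x ^ p * W x ∂ν ≤
      muckenhouptConst p D K * ∫⁻ x, f x ^ p * W x ∂ν := by
  have hpq := Real.HolderConjugate.conjExponent hp
  rw [muckenhouptConst]
  set q := p.conjExponent
  have hq0 : 0 ≤ q := hpq.symm.nonneg
  have hpow : ∀ y : ℝ≥0∞, (y ^ (p - 1)) ^ q = y ^ p := fun y => by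
    rw [← ENNReal.rpow_mul, hpq.sub_one_mul_conj]
  set σ := dualWeight p W with hσdef
  have hσ : IsPosWeight σ := hW.dual p
  have hmax (μ : Measure X) (g : X → ℝ≥0∞) : Measurable (maximal 𝓑.carrier μ g) :=
    measurable_maximal 𝓑.measurableSet μ g
  set m := maximal 𝓑.carrier (ν.withDensity σ) (fun z => f z / σ z)
  have hm : Measurable m := hmax _ _
  set n := maximal 𝓑.carrier (ν.withDensity W) (fun y => m y ^ (p - 1) / W y)
  calc ∫⁻ x, maximal 𝓑.carrier ν f x ^ p * W x ∂ν
      = ∫⁻ x, maximal 𝓑.carrier ν f x ^ p ∂ν.withDensity W := by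
        rw [lintegral_withDensity_eq_lintegral_mul _ hW.measurable ((hmax _ _).pow_const p)]
        simp only [Pi.mul_apply, mul_comm]
    _ ≤ ∫⁻ x, K ^ q * n x ^ q ∂ν.withDensity W := by
        refine lintegral_mono fun x => ?_
        rw [← ENNReal.mul_rpow_of_nonneg _ _ hq0, ← hpow]
        exact ENNReal.rpow_le_rpow (h.maximal_rpow_le hpq h𝓑 hW hK hf x) hq0
    _ = K ^ q * ∫⁻ x, n x ^ q ∂ν.withDensity W := lintegral_const_mul _ ((hmax _ _).pow_const q)
    _ ≤ K ^ q * (K * D ^ p * strongTypeConst q * ∫⁻ x, (m x ^ (p - 1)) ^ q * σ x ∂ν) := by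
        gcongr
        exact h.lintegral_maximal_div_rpow_le hpq h𝓑 hW hK (hm.pow_const (p - 1))
    _ = K ^ q * (K * D ^ p * strongTypeConst q * ∫⁻ x, m x ^ p ∂ν.withDensity σ) := by
        rw [lintegral_withDensity_eq_lintegral_mul _ hσ.measurable (hm.pow_const p)]
        simp only [hpow, Pi.mul_apply, mul_comm (σ _)]
    _ ≤ K ^ q * (K * D ^ p * strongTypeConst q * (K ^ (q - 1) * D ^ q * strongTypeConst p *
          ∫⁻ x, f x ^ p * dualWeight q σ x ∂ν)) := by
        gcongr
        exact (h.dual hpq).lintegral_maximal_div_rpow_le hpq.symm h𝓑 hσ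
          (ENNReal.rpow_ne_top_of_nonneg hpq.symm.sub_one_pos.le hK) hf
    _ = _ := by
        rw [hσdef, dualWeight_dualWeight hpq]
        ring

end Muckenhoupt

/-! ### The Rubio de Francia iteration -/

/-- The Rubio de Francia iteration `∑ n, b⁻ⁿ Mⁿ f`, where `M` is the maximal operator. -/
def iteration {X I : Type*} [MeasurableSpace X] (C : I → Set X) (ν : Measure X) (b : ℝ≥0∞)
    (f : X → ℝ≥0∞) (x : X) : ℝ≥0∞ :=
  ∑' n : ℕ, b⁻¹ ^ n * (maximal C ν)^[n] f x

/-- Twice a bound for the norm of the maximal operator on `L_p(W)`, kept away from zero. -/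
def iterationConst (p : ℝ) (D K : ℝ≥0∞) : ℝ≥0∞ :=
  2 * (muckenhouptConst p D K + 1) ^ (1 / p)

/-- The `A_1` condition for `F` on the sets `C i`, with constant `b`. -/
def HasA1 {X I : Type*} [MeasurableSpace X] (C : I → Set X) (ν : Measure X) (F : X → ℝ≥0∞)
    (b : ℝ≥0∞) : Prop :=
  ∀ᵐ x ∂ν, maximal C ν F x ≤ b * F x

section RubioDeFrancia

variable {X I : Type*} [MeasurableSpace X] {ν : Measure X} {D K b : ℝ≥0∞} {p q : ℝ}
  {C : I → Set X} {W f : X → ℝ≥0∞} {𝓑 : VitaliBasis X I}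

theorem measurable_iterate_maximal [Countable I] (hC : ∀ i, MeasurableSet (C i))
    (hf : Measurable f) (n : ℕ) : Measurable ((maximal C ν)^[n] f) := by
  cases n with
  | zero => exact hf
  | succ n =>
    rw [Function.iterate_succ_apply']
    exact measurable_maximal hC _ _

theorem measurable_iteration [Countable I] (hC : ∀ i, MeasurableSet (C i)) (b : ℝ≥0∞)
    (hf : Measurable f) : Measurable (iteration C ν b f) :=
  Measurable.tsum fun n => (measurable_iterate_maximal hC hf n).const_mul _

theorem le_iteration (C : I → Set X) (ν : Measure X) (b : ℝ≥0∞) (f : X → ℝ≥0∞) (x : X) :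
    f x ≤ iteration C ν b f x := by
  refine le_trans ?_ (ENNReal.le_tsum 0)
  simp

theorem maximal_iteration_le [Countable I] (hC : ∀ i, MeasurableSet (C i)) (hb0 : b ≠ 0)
    (hb : b ≠ ∞) (hf : Measurable f) (x : X) :
    maximal C ν (iteration C ν b f) x ≤ b * iteration C ν b f x := by
  have hM := fun n => measurable_iterate_maximal (ν := ν) hC hf n
  have hterm : ∀ n i, x ∈ C i → (∫⁻ y in C i, b⁻¹ ^ n * (maximal C ν)^[n] f y ∂ν) / ν (C i) ≤
      b * (b⁻¹ ^ (n + 1) * (maximal C ν)^[n + 1] f x) := by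
    intro n i hx
    rw [lintegral_const_mul _ (hM n), mul_div_assoc, pow_succ', ← mul_assoc, ← mul_assoc,
      ENNReal.mul_inv_cancel hb0 hb, one_mul, Function.iterate_succ_apply']
    gcongr
    exact average_le_maximal ν _ hx
  rw [maximal_le_iff]
  intro i hx
  unfold iteration
  calc (∫⁻ y in C i, ∑' n : ℕ, b⁻¹ ^ n * (maximal C ν)^[n] f y ∂ν) / ν (C i)
      = ∑' n : ℕ, (∫⁻ y in C i, b⁻¹ ^ n * (maximal C ν)^[n] f y ∂ν) / ν (C i) := by
        rw [lintegral_tsum fun n => ((hM n).const_mul _).aemeasurable]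
        simp only [div_eq_mul_inv, ENNReal.tsum_mul_right]
    _ ≤ ∑' n : ℕ, b * (b⁻¹ ^ (n + 1) * (maximal C ν)^[n + 1] f x) :=
        ENNReal.tsum_le_tsum fun n => hterm n i hx
    _ = b * ∑' n : ℕ, b⁻¹ ^ (n + 1) * (maximal C ν)^[n + 1] f x := ENNReal.tsum_mul_left
    _ ≤ b * ∑' n : ℕ, b⁻¹ ^ n * (maximal C ν)^[n] f x := by
        gcongr b * ?_
        exact ENNReal.tsum_comp_le_tsum_of_injective (add_left_injective 1)
          (fun n => b⁻¹ ^ n * (maximal C ν)^[n] f x)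

theorem iterationConst_ne_zero (hp : 1 < p) : iterationConst p D K ≠ 0 := by
  refine mul_ne_zero two_ne_zero ?_
  rw [Ne, ENNReal.rpow_eq_zero_iff_of_pos (by positivity)]
  simp

theorem iterationConst_ne_top (hp : 1 < p) (hD : D ≠ ∞) (hK : K ≠ ∞) :
    iterationConst p D K ≠ ∞ := by
  have := muckenhouptConst_ne_top hp hD hK
  have : 0 ≤ 1 / p := by positivity
  unfold iterationConst
  finiteness

theorem HasA1.congr {F G : X → ℝ≥0∞} (h : HasA1 C ν F b) (hFG : F =ᵐ[ν] G) : HasA1 C ν G b := by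
  have : maximal C ν F = maximal C ν G := by
    funext x
    simp only [maximal, lintegral_congr_ae (ae_restrict_of_ae hFG)]
  filter_upwards [h, hFG] with x hx hxFG
  rwa [← this, ← hxFG]

variable [Countable I]

theorem HasAp.weightedLpNorm_maximal_le (h𝓑 : 𝓑.IsDoubling ν D) (hp : 1 < p) (hW : IsPosWeight W)
    (hK : K ≠ ∞) (h : HasAp 𝓑.carrier ν p W K) (hf : Measurable f) :
    weightedLpNorm ν p W (maximal 𝓑.carrier ν f) ≤
      iterationConst p D K / 2 * weightedLpNorm ν p W f := by
  have hp0 : 0 < p := by linarith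
  rw [iterationConst, mul_comm 2, ENNReal.mul_div_cancel_right two_ne_zero ENNReal.ofNat_ne_top,
    weightedLpNorm_le_iff hp0, ENNReal.mul_rpow_of_nonneg _ _ hp0.le, ← ENNReal.rpow_mul,
    one_div_mul_cancel hp0.ne', ENNReal.rpow_one, weightedLpNorm_rpow hp0]
  exact (h.lintegral_maximal_rpow_mul_le h𝓑 hp hW hK hf).trans (by gcongr; exact le_self_add)

theorem HasAp.weightedLpNorm_iterate_maximal_le (h𝓑 : 𝓑.IsDoubling ν D) (hp : 1 < p)
    (hW : IsPosWeight W) (hK : K ≠ ∞) (h : HasAp 𝓑.carrier ν p W K) (hf : Measurable f) (n : ℕ) :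
    weightedLpNorm ν p W ((maximal 𝓑.carrier ν)^[n] f) ≤
      (iterationConst p D K / 2) ^ n * weightedLpNorm ν p W f := by
  induction n with
  | zero => simp
  | succ n ih =>
    rw [Function.iterate_succ_apply', pow_succ', mul_assoc]
    exact (h.weightedLpNorm_maximal_le h𝓑 hp hW hK
      (measurable_iterate_maximal 𝓑.measurableSet hf n)).trans (by gcongr)

theorem HasAp.weightedLpNorm_iteration_le (h𝓑 : 𝓑.IsDoubling ν D) (hp : 1 < p)
    (hW : IsPosWeight W) (hD : D ≠ ∞) (hK : K ≠ ∞) (h : HasAp 𝓑.carrier ν p W K)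
    (hf : Measurable f) :
    weightedLpNorm ν p W (iteration 𝓑.carrier ν (iterationConst p D K) f) ≤
      2 * weightedLpNorm ν p W f := by
  set b := iterationConst p D K
  have hM := fun n => measurable_iterate_maximal (ν := ν) 𝓑.measurableSet hf n
  calc weightedLpNorm ν p W (iteration 𝓑.carrier ν b f)
      ≤ ∑' n : ℕ, weightedLpNorm ν p W (fun x => b⁻¹ ^ n * (maximal 𝓑.carrier ν)^[n] f x) :=
        weightedLpNorm_tsum_le hp.le hW.measurable fun n => (hM n).const_mul _
    _ ≤ ∑' n : ℕ, b⁻¹ ^ n * ((b / 2) ^ n * weightedLpNorm ν p W f) := by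
        refine ENNReal.tsum_le_tsum fun n => ?_
        rw [weightedLpNorm_const_mul (by linarith) hW.measurable (hM n)]
        gcongr
        exact h.weightedLpNorm_iterate_maximal_le h𝓑 hp hW hK hf n
    _ = ∑' n : ℕ, 2⁻¹ ^ n * weightedLpNorm ν p W f := by
        have hb : b⁻¹ * (b / 2) = 2⁻¹ := by
          rw [div_eq_mul_inv, ← mul_assoc, ENNReal.inv_mul_cancel (iterationConst_ne_zero hp)
            (iterationConst_ne_top hp hD hK), one_mul]
        simp_rw [← mul_assoc, ← mul_pow, hb]
    _ = 2 * weightedLpNorm ν p W f := by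
        rw [ENNReal.tsum_mul_right, ENNReal.tsum_geometric, ENNReal.one_sub_inv_two, inv_inv]

-- A small positive function is added to `f` so that the majorant vanishes nowhere.
theorem HasAp.exists_hasA1_ge [SigmaFinite ν] (h𝓑 : 𝓑.IsDoubling ν D) (hp : 1 < p)
    (hW : IsPosWeight W) (hD : D ≠ ∞) (hK : K ≠ ∞) (h : HasAp 𝓑.carrier ν p W K)
    (hf : Measurable f) {a : ℝ≥0∞} (hfa : weightedLpNorm ν p W f < a) :
    ∃ F, IsPosWeight F ∧ HasA1 𝓑.carrier ν F (iterationConst p D K) ∧ f ≤ᵐ[ν] F ∧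
      weightedLpNorm ν p W F ≤ 2 * a := by
  classical
  have hp0 : 0 < p := by linarith
  set b := iterationConst p D K
  obtain ⟨a', hfa', ha'⟩ := exists_between hfa
  obtain ⟨φ, hφ, hφ0, hφa⟩ := exists_pos_weightedLpNorm_le (ν := ν) hp0 hW
    (tsub_pos_of_lt hfa').ne'
  set P := iteration 𝓑.carrier ν b fun x => f x + φ x
  have hP : Measurable P := measurable_iteration 𝓑.measurableSet b (hf.add hφ)
  have hfP : ∀ x, f x + φ x ≤ P x := le_iteration _ _ _ _
  have hPa : weightedLpNorm ν p W P ≤ 2 * a' := by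
    refine (h.weightedLpNorm_iteration_le h𝓑 hp hW hD hK (hf.add hφ)).trans ?_
    gcongr
    refine (weightedLpNorm_add_le hp.le hW.measurable hf hφ).trans ?_
    exact (add_le_add_right hφa _).trans_eq (add_tsub_cancel_of_le hfa'.le)
  have hPt : ∀ᵐ x ∂ν, P x ≠ ∞ :=
    ae_ne_top_of_weightedLpNorm_ne_top hp0 hW hP (ne_top_of_le_ne_top (by finiteness) hPa)
  have hPF : P =ᵐ[ν] fun x => if P x = ∞ then 1 else P x := hPt.mono fun x hx => (if_neg hx).symm
  have hP0 : ∀ x, P x ≠ 0 := fun x hx =>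
    hφ0 x (le_zero_iff.1 (le_add_self.trans ((hfP x).trans hx.le)))
  refine ⟨fun x => if P x = ∞ then 1 else P x, ⟨?_, fun x => ?_, fun x => ?_⟩,
    HasA1.congr (.of_forall ?_) hPF, ?_, ?_⟩
  · exact Measurable.ite (hP (measurableSet_singleton _)) measurable_const hP
  · split_ifs
    exacts [one_ne_zero, hP0 x]
  · split_ifs with hx
    exacts [ENNReal.one_ne_top, hx]
  · exact maximal_iteration_le 𝓑.measurableSet (iterationConst_ne_zero hp)
      (iterationConst_ne_top hp hD hK) (hf.add hφ)
  · filter_upwards [hPF] with x hx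
    exact hx ▸ le_self_add.trans (hfP x)
  · refine (weightedLpNorm_mono_ae hp0 hPF.symm.le).trans (hPa.trans ?_)
    gcongr

end RubioDeFrancia

/-! ### Extrapolation between exponents -/

/-- The weight `F ^ (1 - p) * S` of the Jones factorization of `A_p` weights. -/
def factorWeight {X : Type*} (p : ℝ) (F S : X → ℝ≥0∞) (x : X) : ℝ≥0∞ :=
  F x ^ (1 - p) * S x

theorem rpow_le_rpow_of_nonpos {x y : ℝ≥0∞} {z : ℝ} (hxy : x ≤ y) (hz : z ≤ 0) :
    y ^ z ≤ x ^ z := by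
  rw [← neg_neg z, ENNReal.rpow_neg y, ENNReal.rpow_neg x, ENNReal.inv_le_inv]
  exact ENNReal.rpow_le_rpow hxy (neg_nonneg.2 hz)

theorem rpow_mul_rpow_of_holderConjugate {p q : ℝ} (hpq : p.HolderConjugate q) (a : ℝ≥0∞) :
    a ^ (1 / p) * a ^ (1 / q) = a := by
  rw [← ENNReal.rpow_add_of_nonneg _ _ hpq.one_div_nonneg hpq.symm.one_div_nonneg, one_div,
    one_div, hpq.inv_add_inv_eq_one, ENNReal.rpow_one]

section Extrapolation

variable {X I : Type*} [MeasurableSpace X] {ν : Measure X} {D K N b c : ℝ≥0∞} {p q r : ℝ}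
  {C : I → Set X} {W F S U G h : X → ℝ≥0∞} {𝓑 : VitaliBasis X I}

theorem isPosWeight_factorWeight (hF : IsPosWeight F) (hS : IsPosWeight S) :
    IsPosWeight (factorWeight p F S) :=
  (hF.rpow _).mul hS

theorem dualWeight_factorWeight (hpq : p.HolderConjugate q) (hF : IsPosWeight F)
    (hS : IsPosWeight S) (x : X) :
    dualWeight p (factorWeight p F S) x = F x * dualWeight p S x := by
  rw [dualWeight_eq_rpow hpq, dualWeight_eq_rpow hpq, factorWeight,
    ENNReal.mul_rpow_of_ne_top ((hF.rpow _).ne_top x) (hS.ne_top x), ← ENNReal.rpow_mul,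
    show (1 - p) * (1 - q) = 1 by linear_combination hpq.mul_eq_add, ENNReal.rpow_one]

theorem HasA1.exists_ae_le (hF : IsPosWeight F) (h : HasA1 C ν F b) (hb0 : b ≠ 0) (hb : b ≠ ∞)
    {i : I} (hC : MeasurableSet (C i)) (h0 : ν (C i) ≠ 0) (ht : ν (C i) ≠ ∞) :
    ∃ α, α ≠ 0 ∧ α ≠ ∞ ∧ (∀ᵐ x ∂ν.restrict (C i), α ≤ F x) ∧
      ∫⁻ x in C i, F x ∂ν = b * α * ν (C i) := by
  have hle : ∀ᵐ x ∂ν.restrict (C i), (∫⁻ y in C i, F y ∂ν) / ν (C i) / b ≤ F x := by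
    filter_upwards [ae_restrict_of_ae h, ae_restrict_mem hC] with x hx hxC
    rw [ENNReal.div_le_iff hb0 hb, mul_comm]
    exact (average_le_maximal ν F hxC).trans hx
  refine ⟨_, ?_, ?_, hle, ?_⟩
  · simpa [ENNReal.div_eq_zero_iff, ht, hb] using hF.setLIntegral_ne_zero h0
  · have : (ae (ν.restrict (C i))).NeBot := ae_restrict_neBot.2 h0
    obtain ⟨x, hx⟩ := hle.exists
    exact ne_top_of_le_ne_top (hF.ne_top x) hx
  · rw [ENNReal.mul_div_cancel hb0 hb, ENNReal.div_mul_cancel h0 ht]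

theorem hasAp_factorWeight (hpq : p.HolderConjugate q) (hC : ∀ i, MeasurableSet (C i))
    (h0 : ∀ i, ν (C i) ≠ 0) (ht : ∀ i, ν (C i) ≠ ∞) (hF : IsPosWeight F) (hS : IsPosWeight S)
    (hb0 : b ≠ 0) (hb : b ≠ ∞) (hc0 : c ≠ 0) (hc : c ≠ ∞) (hFA : HasA1 C ν F b)
    (hSA : HasA1 C ν S c) :
    HasAp C ν p (factorWeight p F S) (b ^ (p - 1) * c) := by
  intro i
  have hp1 := hpq.sub_one_pos
  obtain ⟨α, hα0, hα, hαF, hF_int⟩ := hFA.exists_ae_le hF hb0 hb (hC i) (h0 i) (ht i)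
  obtain ⟨β, hβ0, hβ, hβS, hS_int⟩ := hSA.exists_ae_le hS hc0 hc (hC i) (h0 i) (ht i)
  have hweight : ∫⁻ x in C i, factorWeight p F S x ∂ν ≤ α ^ (1 - p) * (c * β * ν (C i)) := by
    rw [← hS_int, ← lintegral_const_mul _ hS.measurable]
    refine lintegral_mono_ae (hαF.mono fun x hx => ?_)
    exact mul_le_mul_left (rpow_le_rpow_of_nonpos hx (by linarith)) _
  have hdual : ∫⁻ x in C i, dualWeight p (factorWeight p F S) x ∂ν ≤
      b * α * ν (C i) * β ^ (1 - q) := by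
    rw [← hF_int, ← lintegral_mul_const _ hF.measurable]
    refine lintegral_mono_ae (hβS.mono fun x hx => ?_)
    simp only [dualWeight_factorWeight hpq hF hS, dualWeight_eq_rpow hpq S]
    have hq1 := hpq.symm.sub_one_pos
    exact mul_le_mul_right (rpow_le_rpow_of_nonpos hx (by linarith)) _
  calc _ ≤ α ^ (1 - p) * (c * β * ν (C i)) * (b * α * ν (C i) * β ^ (1 - q)) ^ (p - 1) := by
        gcongr
    _ = (α ^ (1 - p) * α ^ (p - 1)) * (β * β⁻¹) * (b ^ (p - 1) * c) *
          (ν (C i) * ν (C i) ^ (p - 1)) := by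
        rw [ENNReal.mul_rpow_of_nonneg _ _ hp1.le, ENNReal.mul_rpow_of_nonneg _ _ hp1.le,
          ENNReal.mul_rpow_of_nonneg _ _ hp1.le, ← ENNReal.rpow_mul,
          show (1 - q) * (p - 1) = -1 by linear_combination -hpq.mul_eq_add, ENNReal.rpow_neg_one]
        ring
    _ = b ^ (p - 1) * c * ν (C i) ^ p := by
        nth_rw 1 [← ENNReal.rpow_one (ν (C i))]
        rw [← ENNReal.rpow_add _ _ hα0 hα, ENNReal.mul_inv_cancel hβ0 hβ,
          ← ENNReal.rpow_add _ _ (h0 i) (ht i)]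
        simp

-- Hölder's inequality in `L_p(V)`, where `V = F ^ (1 - p) * S` is such that both the norm of `F`
-- in `L_p(V)` and the norm of `S` in the dual space are powers of `∫ F S`.
theorem lintegral_mul_le_of_factorWeight (hpq : p.HolderConjugate q) (hF : IsPosWeight F)
    (hS : IsPosWeight S) (hU : Measurable U) (hGF : G ≤ᵐ[ν] F)
    (h : weightedLpNorm ν p (factorWeight p F S) U ≤
      N * weightedLpNorm ν p (factorWeight p F S) G) :
    ∫⁻ x, U x * S x ∂ν ≤ N * ∫⁻ x, F x * S x ∂ν := by
  set J := ∫⁻ x, F x * S x ∂ν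
  have hF_norm : weightedLpNorm ν p (factorWeight p F S) F = J ^ (1 / p) := by
    rw [weightedLpNorm]
    congr 1
    refine lintegral_congr fun x => ?_
    rw [factorWeight, ← mul_assoc, ← ENNReal.rpow_add _ _ (hF.ne_zero x) (hF.ne_top x),
      add_sub_cancel, ENNReal.rpow_one]
  have hS_norm : weightedLpNorm ν q (dualWeight p (factorWeight p F S)) S = J ^ (1 / q) := by
    rw [weightedLpNorm]
    congr 1
    refine lintegral_congr fun x => ?_
    rw [dualWeight_factorWeight hpq hF hS, dualWeight_eq_rpow hpq, mul_left_comm,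
      ← ENNReal.rpow_add _ _ (hS.ne_zero x) (hS.ne_top x), add_sub_cancel, ENNReal.rpow_one]
  calc ∫⁻ x, U x * S x ∂ν
      ≤ weightedLpNorm ν p (factorWeight p F S) U *
          weightedLpNorm ν q (dualWeight p (factorWeight p F S)) S :=
        lintegral_mul_le_weightedLpNorm_mul hpq (isPosWeight_factorWeight hF hS) hU.aemeasurable
          hS.measurable.aemeasurable
    _ ≤ N * J ^ (1 / p) * J ^ (1 / q) := by
        rw [hS_norm, ← hF_norm]
        gcongr
        exact h.trans (by gcongr; exact weightedLpNorm_mono_ae hpq.pos hGF)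
    _ = N * J := by
        rw [mul_assoc, rpow_mul_rpow_of_holderConjugate hpq]

theorem exists_measurable_le_lt_lintegral {μ : Measure X} [SigmaFinite μ] {f : X → ℝ≥0∞}
    {L : ℝ≥0∞} (hL : L < ∫⁻ x, f x ∂μ) :
    ∃ g, Measurable g ∧ g ≤ f ∧ ∫⁻ x, g x ∂μ ≠ ∞ ∧ L < ∫⁻ x, g x ∂μ := by
  simp only [lintegral_eq_nnreal, lt_iSup_iff] at hL
  obtain ⟨φ, hφ, hLφ⟩ := hL
  rw [← SimpleFunc.lintegral_eq_lintegral] at hLφ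
  obtain ⟨g, hg, hg_top, hLg⟩ := SimpleFunc.exists_lt_lintegral_simpleFunc_of_lt_lintegral hLφ
  exact ⟨fun x => g x, by fun_prop, fun x => (ENNReal.coe_le_coe.2 (hg x)).trans (hφ x),
    hg_top.ne, hLg⟩

theorem weightedLpNorm_dualWeight_rpow_mul (hpq : p.HolderConjugate q) (hW : IsPosWeight W)
    (g : X → ℝ≥0∞) :
    weightedLpNorm ν q (dualWeight p W) (fun x => g x ^ (1 / q) * W x) =
      (∫⁻ x, g x * W x ∂ν) ^ (1 / q) := by
  rw [weightedLpNorm]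
  congr 1
  refine lintegral_congr fun x => ?_
  rw [ENNReal.mul_rpow_of_nonneg _ _ hpq.symm.nonneg, ← ENNReal.rpow_mul,
    one_div_mul_cancel hpq.symm.ne_zero, ENNReal.rpow_one, dualWeight_eq_rpow hpq, mul_assoc,
    ← ENNReal.rpow_add _ _ (hW.ne_zero x) (hW.ne_top x), add_sub_cancel, ENNReal.rpow_one]

theorem le_rpow_of_le_mul_rpow (hpq : p.HolderConjugate q) {a : ℝ≥0∞} (ha : a ≠ ∞)
    (h : a ≤ N * a ^ (1 / q)) : a ≤ N ^ p := by
  rcases eq_or_ne a 0 with rfl | ha0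
  · exact zero_le
  have hq0 := hpq.symm.one_div_pos
  have ha0' : a ^ (1 / q) ≠ 0 := by rwa [Ne, ENNReal.rpow_eq_zero_iff_of_pos hq0]
  rw [← ENNReal.rpow_inv_le_iff hpq.pos, ← one_div,
    ← ENNReal.mul_le_mul_iff_left ha0' (by finiteness), rpow_mul_rpow_of_holderConjugate hpq]
  exact h

theorem weightedLpNorm_le_of_forall_lintegral_mul_le [SigmaFinite ν] (hpq : p.HolderConjugate q)
    (hW : IsPosWeight W) (hU : Measurable U)
    (h : ∀ f, Measurable f → weightedLpNorm ν q (dualWeight p W) f ≠ ∞ →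
      ∫⁻ x, U x * f x ∂ν ≤ N * weightedLpNorm ν q (dualWeight p W) f) :
    weightedLpNorm ν p W U ≤ N := by
  have hp := hpq.pos
  have := SigmaFinite.withDensity_of_ne_top (μ := ν) (.of_forall hW.ne_top)
  have hdensity : ∀ {g : X → ℝ≥0∞}, Measurable g →
      ∫⁻ x, g x ∂ν.withDensity W = ∫⁻ x, g x * W x ∂ν := fun hg => by
    simp_rw [lintegral_withDensity_eq_lintegral_mul _ hW.measurable hg, Pi.mul_apply, mul_comm]
  rw [weightedLpNorm_le_iff hp, ← hdensity (hU.pow_const p)]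
  refine le_of_forall_lt fun L hL => ?_
  obtain ⟨g, hg, hgU, hJ, hLJ⟩ := exists_measurable_le_lt_lintegral hL
  rw [hdensity hg] at hJ hLJ
  set J := ∫⁻ x, g x * W x ∂ν
  have hJ_norm : weightedLpNorm ν q (dualWeight p W) (fun x => g x ^ (1 / q) * W x) =
      J ^ (1 / q) := weightedLpNorm_dualWeight_rpow_mul hpq hW g
  have hJ_le : J ≤ N * J ^ (1 / q) := by
    have hW_meas := hW.measurable
    have hq0 := hpq.symm.one_div_nonneg
    refine le_trans ?_ (hJ_norm ▸ h _ (by fun_prop) (by rw [hJ_norm]; finiteness))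
    refine lintegral_mono fun x => ?_
    rw [← mul_assoc]
    nth_rw 1 [← rpow_mul_rpow_of_holderConjugate hpq (g x)]
    gcongr
    rw [one_div]
    exact (ENNReal.rpow_inv_le_iff hp).2 (hgU x)
  exact hLJ.trans_le (le_rpow_of_le_mul_rpow hpq hJ hJ_le)

/-- The bound on the `A_p` constants of the weights that extrapolation from `L_p` to `L_q`
requires, given a weight with `A_q` constant `K` and a basis with doubling constant `D`. -/
def extrapolationConst (p q : ℝ) (D K : ℝ≥0∞) : ℝ≥0∞ :=
  iterationConst q D K ^ (p - 1) * iterationConst q.conjExponent D (K ^ (q.conjExponent - 1))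

theorem extrapolationConst_ne_top (hp : 1 < p) (hq : 1 < q) (hD : D ≠ ∞) (hK : K ≠ ∞) :
    extrapolationConst p q D K ≠ ∞ := by
  have hqr := Real.HolderConjugate.conjExponent hq
  have hp1 : 0 ≤ p - 1 := by linarith
  have hq1 := hqr.symm.sub_one_pos.le
  have := iterationConst_ne_top hq hD hK
  have := iterationConst_ne_top hqr.symm.lt hD (ENNReal.rpow_ne_top_of_nonneg hq1 hK)
  unfold extrapolationConst
  finiteness

variable [Countable I] [SigmaFinite ν]

theorem lintegral_mul_le_of_forall_weight (h𝓑 : 𝓑.IsDoubling ν D) (hp : 1 < p) (hq : 1 < q)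
    (hD : D ≠ ∞) (hK : K ≠ ∞) (hW : IsPosWeight W) (hWA : HasAp 𝓑.carrier ν q W K)
    (hU : Measurable U) (hG : Measurable G) (hf : Measurable h)
    (H : ∀ V, IsPosWeight V → HasAp 𝓑.carrier ν p V (extrapolationConst p q D K) →
      weightedLpNorm ν p V U ≤ N * weightedLpNorm ν p V G) {s t : ℝ≥0∞}
    (hs : weightedLpNorm ν q W G < s)
    (ht : weightedLpNorm ν q.conjExponent (dualWeight q W) h < t) :
    ∫⁻ x, U x * h x ∂ν ≤ 4 * N * (s * t) := by
  have hqr := Real.HolderConjugate.conjExponent hq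
  have hKr := ENNReal.rpow_ne_top_of_nonneg hqr.symm.sub_one_pos.le hK
  obtain ⟨F, hF, hFA, hGF, hFs⟩ := hWA.exists_hasA1_ge h𝓑 hq hW hD hK hG hs
  obtain ⟨S, hS, hSA, hhS, hSt⟩ :=
    (hWA.dual hqr).exists_hasA1_ge h𝓑 hqr.symm.lt (hW.dual q) hD hKr hf ht
  have hFS : HasAp 𝓑.carrier ν p (factorWeight p F S) (extrapolationConst p q D K) :=
    hasAp_factorWeight (.conjExponent hp) 𝓑.measurableSet h𝓑.measure_ne_zero h𝓑.measure_ne_top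
      hF hS (iterationConst_ne_zero hq) (iterationConst_ne_top hq hD hK)
      (iterationConst_ne_zero hqr.symm.lt) (iterationConst_ne_top hqr.symm.lt hD hKr) hFA hSA
  calc ∫⁻ x, U x * h x ∂ν ≤ ∫⁻ x, U x * S x ∂ν :=
        lintegral_mono_ae (hhS.mono fun x hx => by gcongr)
    _ ≤ N * ∫⁻ x, F x * S x ∂ν := lintegral_mul_le_of_factorWeight (.conjExponent hp) hF hS hU hGF
        (H _ (isPosWeight_factorWeight hF hS) hFS)
    _ ≤ N * (2 * s * (2 * t)) := by
        gcongr
        exact (lintegral_mul_le_weightedLpNorm_mul hqr hW hF.measurable.aemeasurable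
          hS.measurable.aemeasurable).trans (by gcongr)
    _ = 4 * N * (s * t) := by ring

theorem weightedLpNorm_le_of_forall_weight (h𝓑 : 𝓑.IsDoubling ν D) (hp : 1 < p) (hq : 1 < q)
    (hD : D ≠ ∞) (hK : K ≠ ∞) (hW : IsPosWeight W) (hWA : HasAp 𝓑.carrier ν q W K)
    (hU : Measurable U) (hG : Measurable G) (hN0 : N ≠ 0) (hN : N ≠ ∞)
    (H : ∀ V, IsPosWeight V → HasAp 𝓑.carrier ν p V (extrapolationConst p q D K) →
      weightedLpNorm ν p V U ≤ N * weightedLpNorm ν p V G) :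
    weightedLpNorm ν q W U ≤ 4 * N * weightedLpNorm ν q W G := by
  have hN4 : 4 * N ≠ 0 := mul_ne_zero (by norm_num) hN0
  rcases eq_or_ne (weightedLpNorm ν q W G) ∞ with hGt | hGt
  · simp [hGt, ENNReal.mul_top hN4]
  refine weightedLpNorm_le_of_forall_lintegral_mul_le (.conjExponent hq) hW hU fun f hf hft => ?_
  rw [mul_assoc (4 * N), mul_comm (4 * N), ← ENNReal.div_le_iff hN4 (by finiteness)]
  refine ENNReal.le_mul_of_forall_lt (.inr hft) (.inl hGt) fun s hs t ht => ?_
  rw [ENNReal.div_le_iff hN4 (by finiteness), mul_comm]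
  exact lintegral_mul_le_of_forall_weight h𝓑 hp hq hD hK hW hWA hU hG hf H hs ht

end Extrapolation

/-! ### Boxes -/

/-- `S` is one of the two factors `ℝ`, `[0, ∞)` allowed in a product domain. -/
def IsLineOrHalfLine (S : Set ℝ) : Prop :=
  S = Set.univ ∨ S = Set.Ici 0

/-- The length of the `j`-th edge of the boxes `box k n a`. -/
def side {ι : Type*} (k : ι → ℕ) (n : ℤ) (j : ι) : ℝ :=
  2 ^ (-(n * (k j : ℤ)))

/-- The index set of a countable family of boxes: a scale and a rational corner in the domain. -/
abbrev RatBoxIndex {ι : Type*} (Ω : ι → Set ℝ) : Type _ :=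
  {i : ℤ × (ι → ℚ) // (fun j => (i.2 j : ℝ)) ∈ domain Ω}

/-- The `A_p` condition with constant `K` over all the boxes in the domain. -/
def BoxAp {ι : Type*} [Fintype ι] (Ω : ι → Set ℝ) (k : ι → ℕ) (p : ℝ) (W : (ι → ℝ) → ℝ≥0∞)
    (K : ℝ≥0∞) : Prop :=
  HasAp (fun i : ℤ × domain Ω => box k i.1 i.2) volume p W K

theorem IsLineOrHalfLine.mem_of_le {S : Set ℝ} (hS : IsLineOrHalfLine S) {x y : ℝ} (hx : x ∈ S)
    (hxy : x ≤ y) : y ∈ S := by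
  rcases hS with rfl | rfl
  exacts [trivial, le_trans hx hxy]

theorem IsLineOrHalfLine.exists_rat_le {S : Set ℝ} (hS : IsLineOrHalfLine S) (x : ℝ) {s : ℝ}
    (hs : 0 < s) : ∃ r : ℚ, (r : ℝ) ∈ S ∧ x - 2 * s ≤ r ∧ ∀ y ∈ S, x - s ≤ y → (r : ℝ) ≤ y := by
  rcases hS with rfl | rfl
  · obtain ⟨r, hr, hr'⟩ := exists_rat_btwn (show x - 2 * s < x - s by linarith)
    exact ⟨r, trivial, hr.le, fun y _ hy => hr'.le.trans hy⟩
  · rcases le_or_gt (x - s) 0 with hxs | hxs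
    · exact ⟨0, by simp, by push_cast; linarith, fun y hy _ => by simpa using hy⟩
    · obtain ⟨r, hr, hr'⟩ := exists_rat_btwn (show max (x - 2 * s) 0 < x - s from
        max_lt (by linarith) hxs)
      exact ⟨r, (le_max_right _ _).trans hr.le, (le_max_left _ _).trans hr.le,
        fun y _ hy => hr'.le.trans hy⟩

section Boxes

variable {ι : Type*} {Ω : ι → Set ℝ} {k : ι → ℕ} {n m : ℤ} {a b x y : ι → ℝ}

theorem side_pos (k : ι → ℕ) (n : ℤ) (j : ι) : 0 < side k n j := by
  unfold side
  positivity

theorem side_sub (k : ι → ℕ) (n : ℤ) (r : ℕ) (j : ι) :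
    side k (n - r) j = (2 ^ r) ^ k j * side k n j := by
  rw [side, side, ← pow_mul, ← zpow_natCast, ← zpow_add₀ two_ne_zero]
  congr 1
  push_cast
  ring

theorem side_anti (h : m ≤ n) (j : ι) : side k n j ≤ side k m j := by
  have : m * (k j : ℤ) ≤ n * k j := mul_le_mul_of_nonneg_right h (by positivity)
  exact zpow_le_zpow_right₀ one_le_two (by linarith)

theorem two_pow_mul_side_le (hk : ∀ j, 1 ≤ k j) (n : ℤ) (r : ℕ) (j : ι) :
    2 ^ r * side k n j ≤ side k (n - r) j := by
  rw [side_sub]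
  exact mul_le_mul_of_nonneg_right (le_self_pow₀ (one_le_pow₀ one_le_two) (by have := hk j; omega))
    (side_pos k n j).le

theorem mem_box : x ∈ box k n a ↔ ∀ j, a j ≤ x j ∧ x j < a j + side k n j := by
  simp [box, side]

theorem corner_mem_box (k : ι → ℕ) (n : ℤ) (a : ι → ℝ) : a ∈ box k n a :=
  mem_box.2 fun j => ⟨le_rfl, by linarith [side_pos k n j]⟩

theorem box_subset_domain_iff (hΩ : ∀ j, IsLineOrHalfLine (Ω j)) :
    box k n a ⊆ domain Ω ↔ a ∈ domain Ω := by
  refine ⟨fun h => h (corner_mem_box k n a), fun h x hx j _ => ?_⟩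
  exact (hΩ j).mem_of_le (h j trivial) (mem_box.1 hx j).1

theorem exists_rat_corner_le (hΩ : ∀ j, IsLineOrHalfLine (Ω j)) (a : ι → ℝ) {s : ι → ℝ}
    (hs : ∀ j, 0 < s j) :
    ∃ r : ι → ℚ, (fun j => (r j : ℝ)) ∈ domain Ω ∧ ∀ j, a j - 2 * s j ≤ r j ∧
      ∀ y ∈ Ω j, a j - s j ≤ y → r j ≤ y := by
  choose r hrΩ hr using fun j => (hΩ j).exists_rat_le (a j) (hs j)
  exact ⟨r, fun j _ => hrΩ j, hr⟩

theorem box_subset_box_of_nonempty_inter (hΩ : ∀ j, IsLineOrHalfLine (Ω j)) (hk : ∀ j, 1 ≤ k j)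
    (ha : a ∈ domain Ω) (hmn : m ≤ n) (hab : (box k n a ∩ box k m b).Nonempty) {c : ι → ℝ}
    (hc : ∀ j, b j - 2 * side k m j ≤ c j ∧ ∀ y ∈ Ω j, b j - side k m j ≤ y → c j ≤ y) :
    box k n a ⊆ box k (m - 2) c := by
  obtain ⟨z, hza, hzb⟩ := hab
  refine fun y hy => mem_box.2 fun j => ?_
  have hyΩ := (box_subset_domain_iff hΩ).2 ha hy j trivial
  obtain ⟨hy_ge, hy_lt⟩ := mem_box.1 hy j
  obtain ⟨hza_ge, hza_lt⟩ := mem_box.1 hza j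
  obtain ⟨hzb_ge, hzb_lt⟩ := mem_box.1 hzb j
  have hside := side_anti (k := k) hmn j
  have hbig : 2 ^ 2 * side k m j ≤ side k (m - 2) j := two_pow_mul_side_le hk m 2 j
  exact ⟨(hc j).2 _ hyΩ (by linarith), by linarith [(hc j).1]⟩

theorem measurableSet_box [Countable ι] (k : ι → ℕ) (n : ℤ) (a : ι → ℝ) :
    MeasurableSet (box k n a) :=
  MeasurableSet.univ_pi fun _ => measurableSet_Ico

variable [Fintype ι]

theorem volume_box (k : ι → ℕ) (n : ℤ) (a : ι → ℝ) :
    volume (box k n a) = ∏ j, ENNReal.ofReal (side k n j) := by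
  rw [box, Real.volume_pi_Ico]
  simp [side]

theorem volume_box_ne_zero (k : ι → ℕ) (n : ℤ) (a : ι → ℝ) : volume (box k n a) ≠ 0 := by
  rw [volume_box]
  exact Finset.prod_ne_zero_iff.2 fun j _ => by simpa using side_pos k n j

theorem volume_box_ne_top (k : ι → ℕ) (n : ℤ) (a : ι → ℝ) : volume (box k n a) ≠ ∞ := by
  rw [volume_box]
  exact ENNReal.prod_ne_top fun j _ => ENNReal.ofReal_ne_top

theorem volume_box_sub (k : ι → ℕ) (n : ℤ) (r : ℕ) (a b : ι → ℝ) :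
    volume (box k (n - r) a) = (2 ^ r) ^ (∑ j, k j) * volume (box k n b) := by
  rw [volume_box, volume_box, ← Finset.prod_pow_eq_pow_sum, ← Finset.prod_mul_distrib]
  refine Finset.prod_congr rfl fun j _ => ?_
  rw [side_sub, ENNReal.ofReal_mul (by positivity), ENNReal.ofReal_pow (by positivity),
    ENNReal.ofReal_pow (by positivity), ENNReal.ofReal_ofNat]

theorem restrict_domain_restrict_box (hΩ : ∀ j, IsLineOrHalfLine (Ω j)) (ha : a ∈ domain Ω) :
    (volume.restrict (domain Ω)).restrict (box k n a) = volume.restrict (box k n a) :=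
  Measure.restrict_restrict_of_subset ((box_subset_domain_iff hΩ).2 ha)

theorem restrict_domain_box (hΩ : ∀ j, IsLineOrHalfLine (Ω j)) (ha : a ∈ domain Ω) :
    volume.restrict (domain Ω) (box k n a) = volume (box k n a) :=
  Measure.restrict_eq_self _ ((box_subset_domain_iff hΩ).2 ha)

/-- The boxes with rational corners in the domain, as a basis of differentiation. The enlargement
of a box is two scales larger, with its corner moved down as far as the domain allows. -/
def boxBasis (hΩ : ∀ j, IsLineOrHalfLine (Ω j)) (hk : ∀ j, 1 ≤ k j) :
    VitaliBasis (ι → ℝ) (RatBoxIndex Ω) :=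
  have hcorner (i : RatBoxIndex Ω) :=
    exists_rat_corner_le hΩ (fun j => (i.1.2 j : ℝ)) (side_pos k i.1.1)
  { carrier i := box k i.1.1 fun j => (i.1.2 j : ℝ)
    size i := 2 ^ (-i.1.1)
    enlarge i := ⟨(i.1.1 - 2, (hcorner i).choose), (hcorner i).choose_spec.1⟩
    measurableSet _ := measurableSet_box _ _ _
    nonempty _ := ⟨_, corner_mem_box _ _ _⟩
    size_nonneg _ := by positivity
    subset_enlarge i i' hii' hsize := by
      refine box_subset_box_of_nonempty_inter hΩ hk i.2 ?_ hii' (hcorner i').choose_spec.2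
      by_contra! hlt
      have hle : (2 : ℝ) ^ (1 - i'.1.1) ≤ 2 ^ (-i.1.1) := zpow_le_zpow_right₀ one_le_two (by omega)
      have hpos : (0 : ℝ) < 2 ^ (-i'.1.1) := by positivity
      rw [sub_eq_add_neg, zpow_add₀ two_ne_zero, zpow_one] at hle
      linarith }

theorem isDoubling_boxBasis (hΩ : ∀ j, IsLineOrHalfLine (Ω j)) (hk : ∀ j, 1 ≤ k j) {D : ℝ≥0∞}
    (hD : 4 ^ (∑ j, k j) ≤ D) : (boxBasis hΩ hk).IsDoubling (volume.restrict (domain Ω)) D where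
  measure_ne_zero i := (restrict_domain_box hΩ i.2).trans_ne (volume_box_ne_zero _ _ _)
  measure_ne_top i := (restrict_domain_box hΩ i.2).trans_ne (volume_box_ne_top _ _ _)
  measure_enlarge_le i := by
    have hvol := volume_box_sub k i.1.1 2 (fun j => (((boxBasis hΩ hk).enlarge i).1.2 j : ℝ))
      fun j => (i.1.2 j : ℝ)
    refine (restrict_domain_box hΩ ((boxBasis hΩ hk).enlarge i).2).trans_le ?_
    refine hvol.trans_le (mul_le_mul' ?_ (restrict_domain_box hΩ i.2).ge)
    exact le_trans (by norm_num) hD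

theorem BoxAp.hasAp_boxBasis (hΩ : ∀ j, IsLineOrHalfLine (Ω j)) (hk : ∀ j, 1 ≤ k j) {p : ℝ}
    {W : (ι → ℝ) → ℝ≥0∞} {K : ℝ≥0∞} (h : BoxAp Ω k p W K) :
    HasAp (boxBasis hΩ hk).carrier (volume.restrict (domain Ω)) p W K := by
  intro i
  simp only [boxBasis, restrict_domain_restrict_box hΩ i.2, restrict_domain_box hΩ i.2]
  exact h ⟨i.1.1, _, i.2⟩

-- Each box lies in a box with a rational corner whose edges are at least twice as long.
theorem boxAp_of_hasAp_boxBasis (hΩ : ∀ j, IsLineOrHalfLine (Ω j)) (hk : ∀ j, 1 ≤ k j)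
    {D : ℝ≥0∞} (hD : 4 ^ (∑ j, k j) ≤ D) {p : ℝ} (hp : 1 < p) {W : (ι → ℝ) → ℝ≥0∞} {K : ℝ≥0∞}
    (h : HasAp (boxBasis hΩ hk).carrier (volume.restrict (domain Ω)) p W K) :
    BoxAp Ω k p W (K * D ^ p) := by
  rintro ⟨n, a, ha⟩
  have hp1 : 0 ≤ p - 1 := by linarith
  obtain ⟨b, hb, hab⟩ := exists_rat_corner_le hΩ a fun j => half_pos (side_pos k n j)
  have hsub : box k n a ⊆ box k (n - 1) fun j => (b j : ℝ) := by
    refine fun x hx => mem_box.2 fun j => ?_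
    have hbig : 2 ^ 1 * side k n j ≤ side k (n - 1) j := two_pow_mul_side_le hk n 1 j
    have hba := (hab j).2 (a j) (ha j trivial) (by linarith [side_pos k n j])
    obtain ⟨hx_ge, hx_lt⟩ := mem_box.1 hx j
    exact ⟨hba.trans hx_ge, by linarith [(hab j).1]⟩
  have hb_ap := h ⟨(n - 1, b), hb⟩
  simp only [boxBasis, restrict_domain_restrict_box hΩ hb, restrict_domain_box hΩ hb] at hb_ap
  calc _ ≤ _ := mul_le_mul' (lintegral_mono_set hsub)
        (ENNReal.rpow_le_rpow (lintegral_mono_set hsub) hp1)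
    _ ≤ K * volume (box k (n - 1) fun j => (b j : ℝ)) ^ p := hb_ap
    _ ≤ K * (D * volume (box k n a)) ^ p := by
        gcongr
        refine (volume_box_sub k n 1 _ a).trans_le ?_
        gcongr
        exact le_trans (by gcongr; norm_num) hD
    _ = K * D ^ p * volume (box k n a) ^ p := by
        rw [ENNReal.mul_rpow_of_nonneg _ _ (by linarith), mul_assoc]

theorem weightedLpNorm_le_of_forall_boxAp (hΩ : ∀ j, IsLineOrHalfLine (Ω j))
    (hk : ∀ j, 1 ≤ k j) {D : ℝ≥0∞} (hD : 4 ^ (∑ j, k j) ≤ D) (hDt : D ≠ ∞) {p q : ℝ}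
    (hp : 1 < p) (hq : 1 < q) {K : ℝ≥0∞} (hK : K ≠ ∞) {W : (ι → ℝ) → ℝ≥0∞} (hW : IsPosWeight W)
    (hWA : BoxAp Ω k q W K) {U G : (ι → ℝ) → ℝ≥0∞} (hU : Measurable U) (hG : Measurable G)
    {N : ℝ≥0∞} (hN0 : N ≠ 0) (hN : N ≠ ∞)
    (H : ∀ V, IsPosWeight V → BoxAp Ω k p V (extrapolationConst p q D K * D ^ p) →
      weightedLpNorm (volume.restrict (domain Ω)) p V U ≤
        N * weightedLpNorm (volume.restrict (domain Ω)) p V G) :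
    weightedLpNorm (volume.restrict (domain Ω)) q W U ≤
      4 * N * weightedLpNorm (volume.restrict (domain Ω)) q W G :=
  weightedLpNorm_le_of_forall_weight (isDoubling_boxBasis hΩ hk hD) hp hq hDt hK hW
    (hWA.hasAp_boxBasis hΩ hk) hU hG hN0 hN
    fun V hV hVA => H V hV (boxAp_of_hasAp_boxBasis hΩ hk hD hp hVA)

end Boxes

/-! ### Products of weights -/

section Marginals

open Function

variable {ι : Type*} {X : ι → Type*} [DecidableEq ι] {s t T : Finset ι}

theorem restrict_updateFinset_of_disjoint (h : Disjoint s t) (x : ∀ j, X j) (y : ∀ j : s, X j) :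
    t.restrict (updateFinset x s y) = t.restrict x := by
  ext j
  simp [updateFinset, Finset.disjoint_right.1 h j.2]

variable [∀ j, MeasurableSpace (X j)] (μ : ∀ j, Measure (X j)) [∀ j, SigmaFinite (μ j)]

theorem measurePreserving_restrict₂_prodMk (hst : Disjoint s t) (hs : s ⊆ T) (ht : t ⊆ T)
    (hT : T ⊆ s ∪ t) :
    MeasurePreserving (fun y => (Finset.restrict₂ hs y, Finset.restrict₂ ht y))
      (Measure.pi fun j : T => μ j)
      ((Measure.pi fun j : s => μ j).prod (Measure.pi fun j : t => μ j)) := by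
  obtain rfl : T = s ∪ t := hT.antisymm (Finset.union_subset hs ht)
  convert (measurePreserving_piFinsetUnion hst μ).symm using 1
  refine funext fun y => (MeasurableEquiv.eq_symm_apply _).2 (funext fun ⟨j, hj⟩ => ?_)
  rcases Finset.mem_union.1 hj with h | h
  exacts [Equiv.piFinsetUnion_left X hst h hj, Equiv.piFinsetUnion_right X hst h hj]

theorem lintegral_updateFinset_mul_restrict₂ (hst : Disjoint s t) (ht : t ⊆ T) (hT : T = s ∪ t)
    (x : ∀ j, X j) {Φ : (∀ j, X j) → ℝ≥0∞} (hΦ : Measurable Φ) {V : (∀ j : t, X j) → ℝ≥0∞}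
    (hV : Measurable V) :
    ∫⁻ y, Φ (updateFinset x T y) * V (Finset.restrict₂ ht y) ∂Measure.pi (fun j : T => μ j) =
      ∫⁻ z, lmarginal μ s Φ (updateFinset x t z) * V z ∂Measure.pi (fun j : t => μ j) := by
  subst hT
  set Ψ : (∀ j, X j) → ℝ≥0∞ := fun y => Φ y * V (t.restrict y)
  have hΨ : Measurable Ψ := hΦ.mul (hV.comp (Finset.measurable_restrict t))
  calc _ = lmarginal μ (s ∪ t) Ψ x := by
        simp_rw [Ψ, lmarginal, restrict_updateFinset_of_subset ht]
    _ = lmarginal μ t (lmarginal μ s Ψ) x := by rw [lmarginal_union' μ Ψ hΨ hst]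
    _ = _ := by
        simp_rw [Ψ, lmarginal, restrict_updateFinset_of_disjoint hst, restrict_updateFinset]
        exact lintegral_congr fun z => lintegral_mul_const _ (hΦ.comp measurable_updateFinset)

theorem ae_ae_updateFinset [Fintype ι] (s : Finset ι) {P : (∀ j, X j) → Prop}
    (h : ∀ᵐ x ∂Measure.pi μ, P x) :
    ∀ᵐ x ∂Measure.pi μ, ∀ᵐ y ∂Measure.pi (fun j : s => μ j), P (updateFinset x s y) := by
  have hsplit := measurePreserving_piEquivPiSubtypeProd μ (· ∈ s)
  have hprod := (Measure.measurePreserving_swap.comp hsplit).symm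
    ((MeasurableEquiv.piEquivPiSubtypeProd X (· ∈ s)).trans MeasurableEquiv.prodComm)
      |>.quasiMeasurePreserving.ae h
  have hcompl := Measure.quasiMeasurePreserving_snd.comp hsplit.quasiMeasurePreserving
  convert hcompl.ae (Measure.ae_ae_of_ae_prod hprod)
  rfl

end Marginals

section ProductWeights

/-- `Finset.restrict₂` for real families, with the constant type family made explicit. -/
abbrev restrictCoords {ι : Type*} {s T : Finset ι} (h : s ⊆ T) : (T → ℝ) → s → ℝ :=
  Finset.restrict₂ (π := fun _ => ℝ) h

variable {ι : Type*} {s t T : Finset ι} {Ω : ι → Set ℝ} {k : ι → ℕ}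

theorem IsPosWeight.mul_restrict₂ (hs : s ⊆ T) (ht : t ⊆ T) {f : (s → ℝ) → ℝ≥0∞}
    (hf : IsPosWeight f) {V : (t → ℝ) → ℝ≥0∞} (hV : IsPosWeight V) :
    IsPosWeight fun y : T → ℝ => f (restrictCoords hs y) * V (restrictCoords ht y) where
  measurable := (hf.measurable.comp (Finset.measurable_restrict₂ hs)).mul
    (hV.measurable.comp (Finset.measurable_restrict₂ ht))
  ne_zero _ := mul_ne_zero (hf.ne_zero _) (hV.ne_zero _)
  ne_top _ := ENNReal.mul_ne_top (hf.ne_top _) (hV.ne_top _)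

theorem box_eq_preimage_prod [DecidableEq ι] (hs : s ⊆ T) (ht : t ⊆ T) (hT : T ⊆ s ∪ t) (n : ℤ)
    (a : T → ℝ) :
    box (fun j : T => k j) n a = (fun y => (restrictCoords hs y, restrictCoords ht y)) ⁻¹'
      (box (fun j : s => k j) n (restrictCoords hs a) ×ˢ
        box (fun j : t => k j) n (restrictCoords ht a)) := by
  ext y
  refine ⟨fun h => ⟨fun j _ => h ⟨j, hs j.2⟩ trivial, fun j _ => h ⟨j, ht j.2⟩ trivial⟩, ?_⟩
  rintro ⟨hys, hyt⟩ ⟨j, hj⟩ -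
  rcases Finset.mem_union.1 (hT hj) with h | h
  exacts [hys ⟨j, h⟩ trivial, hyt ⟨j, h⟩ trivial]

theorem setLIntegral_box_mul_restrict₂ [DecidableEq ι] (hst : Disjoint s t) (hs : s ⊆ T)
    (ht : t ⊆ T) (hT : T ⊆ s ∪ t) {f : (s → ℝ) → ℝ≥0∞} (hf : Measurable f)
    {V : (t → ℝ) → ℝ≥0∞} (hV : Measurable V) (n : ℤ) (a : T → ℝ) :
    ∫⁻ y in box (fun j : T => k j) n a, f (restrictCoords hs y) * V (restrictCoords ht y) =
      (∫⁻ z in box (fun j : s => k j) n (restrictCoords hs a), f z) *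
        ∫⁻ z in box (fun j : t => k j) n (restrictCoords ht a), V z := by
  have hsplit := (measurePreserving_restrict₂_prodMk (fun _ => (volume : Measure ℝ)) hst hs ht
    hT).restrict_preimage ((measurableSet_box (fun j : s => k j) n (restrictCoords hs a)).prod
      (measurableSet_box (fun j : t => k j) n (restrictCoords ht a)))
  rw [← box_eq_preimage_prod hs ht hT, ← Measure.prod_restrict] at hsplit
  exact (hsplit.lintegral_comp ((hf.comp measurable_fst).mul (hV.comp measurable_snd))).trans
    (lintegral_prod_mul hf.aemeasurable hV.aemeasurable)

theorem BoxAp.mul_restrict₂ [DecidableEq ι] (hst : Disjoint s t) (hs : s ⊆ T) (ht : t ⊆ T)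
    (hT : T ⊆ s ∪ t) {p : ℝ} (hp : 1 < p) {f : (s → ℝ) → ℝ≥0∞} (hf : IsPosWeight f)
    {V : (t → ℝ) → ℝ≥0∞} (hV : IsPosWeight V) {K L : ℝ≥0∞}
    (hfA : BoxAp (fun j : s => Ω j) (fun j : s => k j) p f K)
    (hVA : BoxAp (fun j : t => Ω j) (fun j : t => k j) p V L) :
    BoxAp (fun j : T => Ω j) (fun j : T => k j) p
      (fun y => f (restrictCoords hs y) * V (restrictCoords ht y)) (K * L) := by
  rintro ⟨n, a, ha⟩
  have hfa := hfA ⟨n, restrictCoords hs a, fun j _ => ha ⟨j, hs j.2⟩ trivial⟩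
  have hVa := hVA ⟨n, restrictCoords ht a, fun j _ => ha ⟨j, ht j.2⟩ trivial⟩
  have hvol : volume (box (fun j : T => k j) n a) =
      volume (box (fun j : s => k j) n (restrictCoords hs a)) *
        volume (box (fun j : t => k j) n (restrictCoords ht a)) := by
    simpa using setLIntegral_box_mul_restrict₂ (k := k) hst hs ht hT
      (f := fun _ => 1) measurable_const (V := fun _ => 1) measurable_const n a
  have hdual : ∀ y : T → ℝ,
      dualWeight p (fun y => f (restrictCoords hs y) * V (restrictCoords ht y)) y =
        dualWeight p f (restrictCoords hs y) * dualWeight p V (restrictCoords ht y) := fun y =>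
    ENNReal.mul_rpow_of_ne_top (hf.ne_top _) (hV.ne_top _) _
  simp_rw [hdual]
  rw [setLIntegral_box_mul_restrict₂ hst hs ht hT hf.measurable hV.measurable,
    setLIntegral_box_mul_restrict₂ hst hs ht hT (hf.dual p).measurable (hV.dual p).measurable,
    hvol, ENNReal.mul_rpow_of_nonneg _ _ (by linarith),
    ENNReal.mul_rpow_of_nonneg _ _ (by linarith), mul_mul_mul_comm, mul_mul_mul_comm K]
  exact mul_le_mul' hfa hVa

theorem boxAp_one {κ : Type*} [Fintype κ] (Ω : κ → Set ℝ) (k : κ → ℕ) {p : ℝ} (hp : 1 < p) :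
    BoxAp Ω k p (fun _ => 1) 1 := by
  rintro ⟨n, a, -⟩
  have hdual : dualWeight p (fun _ : κ → ℝ => 1) = fun _ => 1 := funext fun _ => ENNReal.one_rpow _
  simp only [hdual, setLIntegral_one, one_mul]
  nth_rw 1 [← ENNReal.rpow_one (volume (box k n a))]
  rw [← ENNReal.rpow_add_of_nonneg _ _ zero_le_one (by linarith), add_sub_cancel]

theorem restrict_domain_eq_pi {κ : Type*} [Fintype κ] (Ω : κ → Set ℝ) :
    (volume : Measure (κ → ℝ)).restrict (domain Ω) =
      Measure.pi fun j => (volume : Measure ℝ).restrict (Ω j) := by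
  rw [domain, volume_pi, Measure.restrict_pi_pi]

end ProductWeights

/-! ### Mixed norms -/

section Blocks

variable {d m : ℕ}

/-- The coordinates that are not in the first `i` blocks. -/
def tail (l : Fin (m + 1) → ℕ) (i : Fin (m + 1)) : Finset (Fin d) :=
  Finset.univ.filter fun j => l i ≤ (j : ℕ)

/-- The norm in `L_r(V)`, over the coordinates outside the first `i` blocks, of the mixed norm of
`f` over the first `i` blocks. -/
def tailNorm (Ω : Fin d → Set ℝ) (l : Fin (m + 1) → ℕ) (p : Fin m → ℝ)
    (w : (i : Fin m) → ((block (d := d) l i) → ℝ) → ℝ) (i : Fin (m + 1)) (r : ℝ)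
    (V : (tail (d := d) l i → ℝ) → ℝ≥0∞) (f : (Fin d → ℝ) → ℝ) : ℝ≥0∞ :=
  weightedLpNorm (volume.restrict (domain fun j : tail (d := d) l i => Ω j)) r V
    fun y => partialMixedNorm Ω l p w f i (Function.updateFinset 0 _ y)

/-- After `i` blocks have been integrated out, `u` is bounded by `N` times `g` in `L_r(V)` for all
weights `V` on the remaining coordinates with `A_r` constant at most `Λ`. -/
def HasTailBound (Ω : Fin d → Set ℝ) (k : Fin d → ℕ) (l : Fin (m + 1) → ℕ) (p : Fin m → ℝ)
    (w : (i : Fin m) → ((block (d := d) l i) → ℝ) → ℝ) (u g : (Fin d → ℝ) → ℝ)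
    (i : Fin (m + 1)) (r : ℝ) (Λ N : ℝ≥0∞) : Prop :=
  ∀ V : (tail (d := d) l i → ℝ) → ℝ≥0∞, IsPosWeight V →
    BoxAp (fun j : tail (d := d) l i => Ω j) (fun j => k j) r V Λ →
    tailNorm Ω l p w i r V u ≤ N * tailNorm Ω l p w i r V g

theorem block_subset_tail (l : Fin (m + 1) → ℕ) (i : Fin m) :
    block (d := d) l i ⊆ tail l i.castSucc := by
  grind [block, tail]

theorem disjoint_block_tail (l : Fin (m + 1) → ℕ) (i : Fin m) :
    Disjoint (block (d := d) l i) (tail l i.succ) := by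
  grind [block, tail, Finset.disjoint_left]

theorem tail_castSucc_sdiff_block_subset (l : Fin (m + 1) → ℕ) (i : Fin m) :
    tail (d := d) l i.castSucc \ block l i ⊆ tail l i.succ := by
  grind [block, tail]

theorem tail_castSucc {l : Fin (m + 1) → ℕ} (hl : Monotone l) (i : Fin m) :
    tail (d := d) l i.castSucc = block l i ∪ tail l i.succ := by
  have := hl i.castSucc_lt_succ.le
  grind [block, tail]

theorem tail_zero {l : Fin (m + 1) → ℕ} (h0 : l 0 = 0) : tail (d := d) l 0 = Finset.univ := by
  simp [tail, h0]

theorem tail_last {l : Fin (m + 1) → ℕ} (hd : l (Fin.last m) = d) :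
    tail (d := d) l (Fin.last m) = ∅ := by
  grind [tail]

variable {Ω : Fin d → Set ℝ} {k : Fin d → ℕ} {l : Fin (m + 1) → ℕ} {p : Fin m → ℝ}
  {w w' : (i : Fin m) → ((block (d := d) l i) → ℝ) → ℝ} {f f' u g : (Fin d → ℝ) → ℝ}

theorem partialMixedNorm_succ (Ω : Fin d → Set ℝ) (p : Fin m → ℝ)
    (w : (i : Fin m) → ((block (d := d) l i) → ℝ) → ℝ) (f : (Fin d → ℝ) → ℝ)
    (i : Fin m) (x : Fin d → ℝ) :
    partialMixedNorm Ω l p w f i.succ x =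
      (lmarginal (fun j => (volume : Measure ℝ).restrict (Ω j)) (block l i)
        (fun y => partialMixedNorm Ω l p w f i.castSucc y ^ p i *
          ENNReal.ofReal (w i ((block l i).restrict y))) x) ^ (1 / p i) :=
  rfl

theorem measurable_partialMixedNorm_rpow_mul (hw : ∀ i, IsPosWeight fun y => ENNReal.ofReal (w i y))
    {i : Fin m} (hf : Measurable (partialMixedNorm Ω l p w f i.castSucc)) :
    Measurable fun y => partialMixedNorm Ω l p w f i.castSucc y ^ p i *
      ENNReal.ofReal (w i ((block l i).restrict y)) :=
  (hf.pow_const _).mul ((hw i).measurable.comp (Finset.measurable_restrict _))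

theorem measurable_partialMixedNorm (hw : ∀ i, IsPosWeight fun y => ENNReal.ofReal (w i y))
    (hf : Measurable f) (i : Fin (m + 1)) : Measurable (partialMixedNorm Ω l p w f i) := by
  induction i using Fin.induction with
  | zero => exact hf.enorm
  | succ i ih => exact ((measurable_partialMixedNorm_rpow_mul hw ih).lmarginal _).pow_const _

theorem partialMixedNorm_congr_ae
    (hw : ∀ i, w i =ᵐ[volume.restrict (domain fun j : block (d := d) l i => Ω j)] w' i)
    (hf : f =ᵐ[volume.restrict (domain Ω)] f') (i : Fin (m + 1)) :
    partialMixedNorm Ω l p w f i =ᵐ[volume.restrict (domain Ω)] partialMixedNorm Ω l p w' f' i := by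
  simp_rw [Filter.EventuallyEq, restrict_domain_eq_pi] at hw hf ⊢
  induction i using Fin.induction with
  | zero => exact hf.mono fun x hx => congrArg (‖·‖ₑ) hx
  | succ i ih =>
    filter_upwards [ae_ae_updateFinset _ (block l i) ih] with x hx
    rw [partialMixedNorm_succ, partialMixedNorm_succ]
    congr 1
    refine lintegral_congr_ae ?_
    filter_upwards [hx, hw i] with y hxy hwy
    rw [hxy, Function.restrict_updateFinset, hwy]

theorem dependsOn_partialMixedNorm (h0 : l 0 = 0) (i : Fin (m + 1)) :
    DependsOn (partialMixedNorm Ω l p w f i) (tail (d := d) l i) := by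
  induction i using Fin.induction with
  | zero => simpa [tail_zero h0] using dependsOn_univ _
  | succ i ih =>
    intro x y hxy
    rw [partialMixedNorm_succ, partialMixedNorm_succ]
    congr 1
    refine lintegral_congr fun z => ?_
    dsimp only
    rw [Function.restrict_updateFinset, Function.restrict_updateFinset]
    congr 2
    refine ih.updateFinset z fun j hj => hxy j (tail_castSucc_sdiff_block_subset l i ?_)
    simpa using hj

theorem mixedNorm_congr_ae (hΩ : ∀ j, IsLineOrHalfLine (Ω j)) (h0 : l 0 = 0)
    (hd : l (Fin.last m) = d)
    (hw : ∀ i, w i =ᵐ[volume.restrict (domain fun j : block (d := d) l i => Ω j)] w' i)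
    (hf : f =ᵐ[volume.restrict (domain Ω)] f') : mixedNorm Ω l p w f = mixedNorm Ω l p w' f' := by
  have hne : volume.restrict (domain Ω) ≠ 0 := fun h => by
    have hbox := restrict_domain_box (k := fun _ => 1) (n := 0) (a := 0) hΩ
      fun j _ => by rcases hΩ j with hj | hj <;> simp [hj]
    exact volume_box_ne_zero _ 0 0 (by rw [← hbox, h]; rfl)
  have : (ae (volume.restrict (domain Ω))).NeBot := ae_neBot.2 hne
  obtain ⟨x, hx⟩ := (partialMixedNorm_congr_ae (p := p) hw hf (Fin.last m)).exists
  have hconst (v f) : mixedNorm Ω l p v f = partialMixedNorm Ω l p v f (Fin.last m) x :=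
    dependsOn_partialMixedNorm h0 _ fun j hj => by simp [tail_last hd] at hj
  rw [hconst, hconst, hx]

theorem tailNorm_castSucc (hl : Monotone l) (hw : ∀ i, IsPosWeight fun y => ENNReal.ofReal (w i y))
    (hf : Measurable f) {i : Fin m} (hp : 0 < p i) (ht : tail l i.succ ⊆ tail (d := d) l i.castSucc)
    {V : (tail (d := d) l i.succ → ℝ) → ℝ≥0∞} (hV : Measurable V) :
    tailNorm Ω l p w i.castSucc (p i) (fun y =>
        ENNReal.ofReal (w i (restrictCoords (block_subset_tail l i) y)) *
          V (restrictCoords ht y)) f =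
      tailNorm Ω l p w i.succ (p i) V f := by
  have hfub := lintegral_updateFinset_mul_restrict₂ (fun j => (volume : Measure ℝ).restrict (Ω j))
    (disjoint_block_tail l i) ht (tail_castSucc hl i) 0
    (measurable_partialMixedNorm_rpow_mul (Ω := Ω) (p := p) hw (i := i)
      (measurable_partialMixedNorm hw hf _)) hV
  rw [tailNorm, tailNorm, weightedLpNorm, weightedLpNorm, restrict_domain_eq_pi,
    restrict_domain_eq_pi]
  congr 1
  refine Eq.trans (lintegral_congr fun y => ?_) (hfub.trans (lintegral_congr fun z => ?_))
  · rw [Function.restrict_updateFinset_of_subset (block_subset_tail l i), mul_assoc]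
  · rw [partialMixedNorm_succ, ← ENNReal.rpow_mul, one_div_mul_cancel hp.ne', ENNReal.rpow_one]

theorem HasTailBound.succ (hΩ : ∀ j, IsLineOrHalfLine (Ω j)) (hk : ∀ j, 1 ≤ k j) (hl : Monotone l)
    (hw : ∀ i, IsPosWeight fun y => ENNReal.ofReal (w i y)) (hu : Measurable u) (hg : Measurable g)
    {i : Fin m} (hp : 1 < p i) {K : ℝ≥0∞}
    (hwA : BoxAp (fun j : block (d := d) l i => Ω j) (fun j => k j) (p i)
      (fun y => ENNReal.ofReal (w i y)) K)
    {D : ℝ≥0∞} (hD : 4 ^ (∑ j, k j) ≤ D) (hDt : D ≠ ∞) {r : ℝ} (hr : 1 < r) {Λ N : ℝ≥0∞}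
    (hKΛ : K * Λ ≠ ∞) (hN0 : N ≠ 0) (hN : N ≠ ∞)
    (h : HasTailBound Ω k l p w u g i.castSucc r (extrapolationConst r (p i) D (K * Λ) * D ^ r) N) :
    HasTailBound Ω k l p w u g i.succ (p i) Λ (4 * N) := by
  intro V hV hVA
  have hT := tail_castSucc (d := d) hl i
  have ht : tail l i.succ ⊆ tail (d := d) l i.castSucc := hT ▸ Finset.subset_union_right
  have hDtail : 4 ^ (∑ j : tail (d := d) l i.castSucc, k j) ≤ D := by
    refine le_trans (pow_le_pow_right₀ (by norm_num) ?_) hD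
    rw [Finset.sum_coe_sort _ k]
    exact Finset.sum_le_univ_sum_of_nonneg fun _ => zero_le
  have hmeas {f : (Fin d → ℝ) → ℝ} (hf : Measurable f) :
      Measurable fun y : tail (d := d) l i.castSucc → ℝ =>
        partialMixedNorm Ω l p w f i.castSucc (Function.updateFinset 0 _ y) :=
    (measurable_partialMixedNorm hw hf _).comp measurable_updateFinset
  rw [← tailNorm_castSucc hl hw hu (by linarith) ht hV.measurable,
    ← tailNorm_castSucc hl hw hg (by linarith) ht hV.measurable]
  exact weightedLpNorm_le_of_forall_boxAp (Ω := fun j : tail (d := d) l i.castSucc => Ω j)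
    (k := fun j => k j) (fun j => hΩ j) (fun j => hk j) hDtail hDt hr hp hKΛ
    ((hw i).mul_restrict₂ (block_subset_tail l i) ht hV)
    (hwA.mul_restrict₂ (disjoint_block_tail l i) (block_subset_tail l i) ht hT.le hp (hw i) hV hVA)
    (hmeas hu) (hmeas hg) hN0 hN h

theorem tailNorm_last_one (hd : l (Fin.last m) = d) {r : ℝ} (hr : r ≠ 0) (f : (Fin d → ℝ) → ℝ) :
    tailNorm Ω l p w (Fin.last m) r (fun _ => 1) f = mixedNorm Ω l p w f := by
  have hempty : IsEmpty (tail (d := d) l (Fin.last m)) := by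
    rw [tail_last hd]
    infer_instance
  have hpoint (y : tail (d := d) l (Fin.last m) → ℝ) :
      Function.updateFinset (0 : Fin d → ℝ) _ y = 0 := by
    ext j
    simp [Function.updateFinset, tail_last hd]
  simp_rw [tailNorm, weightedLpNorm, hpoint, mul_one]
  rw [restrict_domain_eq_pi, Measure.pi_of_empty, lintegral_const, measure_univ, mul_one,
    ← ENNReal.rpow_mul, mul_one_div_cancel hr, ENNReal.rpow_one, mixedNorm]

/-- The `A_r` constants for which the starting estimate has to be assumed after `i` blocks, for
the exponents `r`. They are determined backwards from the last stage, where no coordinates are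
left. -/
def tailConst (r : Fin (m + 1) → ℝ) (D K : ℝ≥0∞) : Fin (m + 1) → ℝ≥0∞ :=
  Fin.reverseInduction (motive := fun _ => ℝ≥0∞) 1 fun i Λ =>
    extrapolationConst (r i.castSucc) (r i.succ) D (K * Λ) * D ^ r i.castSucc

theorem tailConst_last (r : Fin (m + 1) → ℝ) (D K : ℝ≥0∞) : tailConst r D K (Fin.last m) = 1 :=
  Fin.reverseInduction_last ..

theorem tailConst_castSucc (r : Fin (m + 1) → ℝ) (D K : ℝ≥0∞) (i : Fin m) :
    tailConst r D K i.castSucc =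
      extrapolationConst (r i.castSucc) (r i.succ) D (K * tailConst r D K i.succ) *
        D ^ r i.castSucc :=
  Fin.reverseInduction_castSucc ..

theorem tailConst_ne_top {r : Fin (m + 1) → ℝ} (hr : ∀ i, 1 < r i) {D K : ℝ≥0∞} (hD : D ≠ ∞)
    (hK : K ≠ ∞) (i : Fin (m + 1)) : tailConst r D K i ≠ ∞ := by
  induction i using Fin.reverseInduction with
  | last => simp [tailConst_last]
  | cast i ih =>
    rw [tailConst_castSucc]
    exact ENNReal.mul_ne_top (extrapolationConst_ne_top (hr _) (hr _) hD (ENNReal.mul_ne_top hK ih))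
      (ENNReal.rpow_ne_top_of_nonneg (zero_le_one.trans (hr _).le) hD)

theorem one_lt_cons {p₀ : ℝ} (hp₀ : 1 < p₀) (hp : ∀ i, 1 < p i) (i : Fin (m + 1)) :
    1 < (Fin.cons p₀ p : Fin (m + 1) → ℝ) i :=
  Fin.cases hp₀ hp i

theorem HasTailBound.mixedNorm_le (hΩ : ∀ j, IsLineOrHalfLine (Ω j)) (hk : ∀ j, 1 ≤ k j)
    (hl : Monotone l) (hd : l (Fin.last m) = d)
    (hw : ∀ i, IsPosWeight fun y => ENNReal.ofReal (w i y)) (hu : Measurable u) (hg : Measurable g)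
    {p₀ : ℝ} (hp₀ : 1 < p₀) (hp : ∀ i, 1 < p i) {K : ℝ≥0∞} (hK : K ≠ ∞)
    (hwA : ∀ i, BoxAp (fun j : block (d := d) l i => Ω j) (fun j => k j) (p i)
      (fun y => ENNReal.ofReal (w i y)) K) {N : ℝ≥0∞} (hN0 : N ≠ 0) (hN : N ≠ ∞)
    (h : HasTailBound Ω k l p w u g 0 p₀ (tailConst (Fin.cons p₀ p) (4 ^ ∑ j, k j) K 0) N) :
    mixedNorm Ω l p w u ≤ 4 ^ m * N * mixedNorm Ω l p w g := by
  set r : Fin (m + 1) → ℝ := Fin.cons p₀ p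
  set D : ℝ≥0∞ := 4 ^ ∑ j, k j
  have hr : ∀ i, 1 < r i := one_lt_cons hp₀ hp
  have hD : D ≠ ∞ := ENNReal.pow_ne_top ENNReal.ofNat_ne_top
  have hstage (i : Fin (m + 1)) :
      HasTailBound Ω k l p w u g i (r i) (tailConst r D K i) (4 ^ (i : ℕ) * N) := by
    induction i using Fin.induction with
    | zero =>
      rw [Fin.val_zero, pow_zero, one_mul]
      exact h
    | succ i ih =>
      rw [tailConst_castSucc] at ih
      rw [Fin.val_succ, pow_succ', mul_assoc]
      exact ih.succ hΩ hk hl hw hu hg (hp i) (hwA i) le_rfl hD (hr _)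
        (ENNReal.mul_ne_top hK (tailConst_ne_top hr hD hK _)) (by simp [hN0])
        (ENNReal.mul_ne_top (by simp) hN)
  have hlast := hstage (Fin.last m) (fun _ => 1) ⟨measurable_const, by simp, by simp⟩
    (by rw [tailConst_last]; exact boxAp_one _ _ (hr _))
  have hr0 : r (Fin.last m) ≠ 0 := (zero_lt_one.trans (hr _)).ne'
  rwa [tailNorm_last_one hd hr0, tailNorm_last_one hd hr0] at hlast

end Blocks

/-! ### Passage between real and extended nonnegative weights -/

section RealWeights

variable {ι : Type*} [Fintype ι] {Ω : ι → Set ℝ} {k : ι → ℕ} {p : ℝ} {K : ℝ≥0∞}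

theorem div_mul_div_rpow_le_iff {A B v : ℝ≥0∞} (hp : 1 < p) (hv0 : v ≠ 0) (hvt : v ≠ ∞) :
    A / v * (B / v) ^ (p - 1) ≤ K ↔ A * B ^ (p - 1) ≤ K * v ^ p := by
  have h0 : v ^ p ≠ 0 := by rwa [Ne, ENNReal.rpow_eq_zero_iff_of_pos (by linarith)]
  have ht : v ^ p ≠ ∞ := ENNReal.rpow_ne_top_of_nonneg (by linarith) hvt
  have hv : v ^ p = v * v ^ (p - 1) := by
    nth_rw 2 [← ENNReal.rpow_one v]
    rw [← ENNReal.rpow_add _ _ hv0 hvt, add_sub_cancel]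
  rw [← ENNReal.mul_le_mul_iff_left h0 ht]
  nth_rw 1 [hv]
  rw [mul_mul_mul_comm, ← ENNReal.mul_rpow_of_nonneg _ _ (by linarith),
    ENNReal.div_mul_cancel hv0 hvt, ENNReal.div_mul_cancel hv0 hvt]

theorem apConst_le_iff (hΩ : ∀ j, IsLineOrHalfLine (Ω j)) (hp : 1 < p) {w : (ι → ℝ) → ℝ} :
    apConst Ω k p w ≤ K ↔ BoxAp Ω k p (fun x => ENNReal.ofReal (w x)) K := by
  simp only [apConst, iSup_le_iff, BoxAp, HasAp, Prod.forall, Subtype.forall,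
    box_subset_domain_iff hΩ, setLAverage_eq]
  exact forall₃_congr fun n a _ =>
    div_mul_div_rpow_le_iff hp (volume_box_ne_zero k n a) (volume_box_ne_top k n a)

theorem BoxAp.congr_ae (hΩ : ∀ j, IsLineOrHalfLine (Ω j)) {W W' : (ι → ℝ) → ℝ≥0∞}
    (h : BoxAp Ω k p W K) (hW : W =ᵐ[volume.restrict (domain Ω)] W') : BoxAp Ω k p W' K := by
  rintro ⟨n, a, ha⟩
  have hbox : W =ᵐ[volume.restrict (box k n a)] W' :=
    ae_restrict_of_ae_restrict_of_subset ((box_subset_domain_iff hΩ).2 ha) hW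
  have hdual : dualWeight p W =ᵐ[volume.restrict (box k n a)] dualWeight p W' :=
    hbox.fun_comp (· ^ (-1 / (p - 1)))
  dsimp only
  rw [← lintegral_congr_ae hbox, ← lintegral_congr_ae hdual]
  exact h ⟨n, a, ha⟩

theorem IsApWeight.exists_isPosWeight {w : (ι → ℝ) → ℝ} (h : IsApWeight Ω k p w) :
    ∃ w' : (ι → ℝ) → ℝ, (IsPosWeight fun x => ENNReal.ofReal (w' x)) ∧
      w =ᵐ[volume.restrict (domain Ω)] w' := by
  classical
  have hm := h.aemeasurable.measurable_mk
  refine ⟨fun x => if 0 < h.aemeasurable.mk w x then h.aemeasurable.mk w x else 1, ⟨?_, ?_, ?_⟩, ?_⟩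
  · exact (Measurable.ite (measurableSet_lt measurable_const hm) hm measurable_const).ennreal_ofReal
  · intro x
    rw [ENNReal.ofReal_ne_zero_iff]
    dsimp only
    split_ifs with hx
    exacts [hx, one_pos]
  · exact fun _ => ENNReal.ofReal_ne_top
  · filter_upwards [h.pos, h.aemeasurable.ae_eq_mk] with x hpos hmk
    rw [← hmk, if_pos hpos]

theorem IsPosWeight.isApWeight_toReal (hΩ : ∀ j, IsLineOrHalfLine (Ω j)) (hp : 1 < p)
    {V : (ι → ℝ) → ℝ≥0∞} (hV : IsPosWeight V) (hVA : BoxAp Ω k p V K) (hK : K ≠ ∞) :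
    IsApWeight Ω k p (fun x => (V x).toReal) ∧ apConst Ω k p (fun x => (V x).toReal) ≤ K := by
  have hA : apConst Ω k p (fun x => (V x).toReal) ≤ K := by
    rw [apConst_le_iff hΩ hp]
    simpa only [ENNReal.ofReal_toReal (hV.ne_top _)] using hVA
  exact ⟨⟨hV.measurable.ennreal_toReal.aemeasurable,
    .of_forall fun x => ENNReal.toReal_pos (hV.ne_zero x) (hV.ne_top x), hA.trans_lt hK.lt_top⟩, hA⟩

end RealWeights

section FullTail

variable {ι : Type*} [Fintype ι] {T : Finset ι}

theorem lintegral_pi_eq_lintegral_updateFinset [DecidableEq ι] (hT : T = Finset.univ)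
    {X : ι → Type*} [∀ j, MeasurableSpace (X j)] (μ : ∀ j, Measure (X j)) [∀ j, SigmaFinite (μ j)]
    (Φ : (∀ j, X j) → ℝ≥0∞) (x : ∀ j, X j) :
    ∫⁻ y, Φ y ∂Measure.pi μ =
      ∫⁻ z, Φ (Function.updateFinset x T z) ∂Measure.pi fun j : T => μ j := by
  subst hT
  exact lintegral_eq_lmarginal_univ x

theorem setLIntegral_box_restrict (hT : T = Finset.univ) (k : ι → ℕ) (n : ℤ) (a : ι → ℝ)
    (V : (T → ℝ) → ℝ≥0∞) :
    ∫⁻ x in box k n a, V (T.restrict x) =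
      ∫⁻ y in box (fun j : T => k j) n (T.restrict a), V y := by
  classical
  have hmem (y : T → ℝ) : Function.updateFinset (0 : ι → ℝ) T y ∈ box k n a ↔
      y ∈ box (fun j : T => k j) n (T.restrict a) := by
    simp [mem_box, side, Function.updateFinset, hT]
  rw [← lintegral_indicator (measurableSet_box _ _ _), ← lintegral_indicator
    (measurableSet_box _ _ _), volume_pi, lintegral_pi_eq_lintegral_updateFinset hT _ _ 0]
  refine lintegral_congr fun y => ?_
  simp only [Set.indicator_apply, hmem, Function.restrict_updateFinset]

theorem BoxAp.comp_restrict (hT : T = Finset.univ) {Ω : ι → Set ℝ} {k : ι → ℕ} {p : ℝ}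
    {V : (T → ℝ) → ℝ≥0∞} {K : ℝ≥0∞} (h : BoxAp (fun j : T => Ω j) (fun j => k j) p V K) :
    BoxAp Ω k p (fun x => V (T.restrict x)) K := by
  rintro ⟨n, a, ha⟩
  have hvol : volume (box k n a) = volume (box (fun j : T => k j) n (T.restrict a)) := by
    simpa using setLIntegral_box_restrict hT k n a fun _ => 1
  have hdual := setLIntegral_box_restrict hT k n a (dualWeight p V)
  dsimp only
  rw [setLIntegral_box_restrict hT, hvol]
  exact hdual ▸ h ⟨n, _, fun j _ => ha j trivial⟩

theorem tailNorm_zero {d m : ℕ} {l : Fin (m + 1) → ℕ} (h0 : l 0 = 0) (Ω : Fin d → Set ℝ)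
    (p : Fin m → ℝ) (w : (i : Fin m) → ((block (d := d) l i) → ℝ) → ℝ) (r : ℝ)
    {V : (tail (d := d) l 0 → ℝ) → ℝ≥0∞} (hV : ∀ y, V y ≠ ∞) {f f' : (Fin d → ℝ) → ℝ}
    (hf : f =ᵐ[volume.restrict (domain Ω)] f') :
    tailNorm Ω l p w 0 r V f' =
      weightedNorm Ω r (fun x => (V ((tail l 0).restrict x)).toReal) f := by
  have hcongr : ∫⁻ x in domain Ω, ‖f x‖ₑ ^ r * V ((tail l 0).restrict x) =
      ∫⁻ x in domain Ω, ‖f' x‖ₑ ^ r * V ((tail l 0).restrict x) :=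
    lintegral_congr_ae (hf.mono fun x hx => by simp only [hx])
  simp_rw [weightedNorm, ENNReal.ofReal_toReal (hV _)]
  rw [hcongr, restrict_domain_eq_pi, tailNorm, weightedLpNorm, restrict_domain_eq_pi,
    lintegral_pi_eq_lintegral_updateFinset (tail_zero h0) _ _ 0]
  simp_rw [Function.restrict_updateFinset]
  rfl

theorem hasTailBound_zero {d m : ℕ} {Ω : Fin d → Set ℝ} (hΩ : ∀ j, IsLineOrHalfLine (Ω j))
    {k : Fin d → ℕ} {l : Fin (m + 1) → ℕ} (h0 : l 0 = 0) (p : Fin m → ℝ)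
    (w : (i : Fin m) → ((block (d := d) l i) → ℝ) → ℝ) {u u' g g' : (Fin d → ℝ) → ℝ}
    (hu : u =ᵐ[volume.restrict (domain Ω)] u') (hg : g =ᵐ[volume.restrict (domain Ω)] g')
    {r : ℝ} (hr : 1 < r) {Λ N : ℝ≥0∞} (hΛ : Λ ≠ ∞)
    (H : ∀ v, IsApWeight Ω k r v → apConst Ω k r v ≤ Λ →
      weightedNorm Ω r v u ≤ N * weightedNorm Ω r v g) :
    HasTailBound Ω k l p w u' g' 0 r Λ N := by
  intro V hV hVA
  have hV' : IsPosWeight fun x : Fin d → ℝ => V ((tail l 0).restrict x) :=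
    ⟨hV.measurable.comp (Finset.measurable_restrict _), fun _ => hV.ne_zero _,
      fun _ => hV.ne_top _⟩
  obtain ⟨hv, hvA⟩ := hV'.isApWeight_toReal hΩ hr (hVA.comp_restrict (tail_zero h0)) hΛ
  rw [tailNorm_zero h0 Ω p w r hV.ne_top hu, tailNorm_zero h0 Ω p w r hV.ne_top hg]
  exact H _ hv hvA

end FullTail

theorem mixedNorm_le_of_forall_weightedNorm_le {d m : ℕ} {Ω : Fin d → Set ℝ}
    (hΩ : ∀ j, IsLineOrHalfLine (Ω j)) {k : Fin d → ℕ} (hk : ∀ j, 1 ≤ k j)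
    {l : Fin (m + 1) → ℕ} (hl : Monotone l) (h0 : l 0 = 0) (hd : l (Fin.last m) = d)
    {p₀ : ℝ} (hp₀ : 1 < p₀) {p : Fin m → ℝ} (hp : ∀ i, 1 < p i)
    {w : (i : Fin m) → ((block (d := d) l i) → ℝ) → ℝ} {K N : ℝ≥0∞} (hK : K ≠ ∞)
    (hw : ∀ i, IsApWeight (fun j : block l i => Ω j) (fun j => k j) (p i) (w i))
    (hwK : ∀ i, apConst (fun j : block l i => Ω j) (fun j => k j) (p i) (w i) ≤ K)
    {u g : (Fin d → ℝ) → ℝ} (hu : AEMeasurable u (volume.restrict (domain Ω)))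
    (hg : AEMeasurable g (volume.restrict (domain Ω))) (hN0 : N ≠ 0) (hN : N ≠ ∞)
    (H : ∀ v, IsApWeight Ω k p₀ v →
      apConst Ω k p₀ v ≤ tailConst (Fin.cons p₀ p) (4 ^ ∑ j, k j) K 0 →
      weightedNorm Ω p₀ v u ≤ N * weightedNorm Ω p₀ v g) :
    mixedNorm Ω l p w u ≤ 4 ^ m * N * mixedNorm Ω l p w g := by
  choose w' hw' hww' using fun i => (hw i).exists_isPosWeight
  have hwA (i : Fin m) : BoxAp (fun j : block (d := d) l i => Ω j) (fun j => k j) (p i)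
      (fun x => ENNReal.ofReal (w' i x)) K :=
    have hΩi (j : block (d := d) l i) := hΩ j
    ((apConst_le_iff hΩi (hp i)).1 (hwK i)).congr_ae hΩi ((hww' i).fun_comp ENNReal.ofReal)
  have hΛ : tailConst (Fin.cons p₀ p) (4 ^ ∑ j, k j) K 0 ≠ ∞ :=
    tailConst_ne_top (one_lt_cons hp₀ hp) (ENNReal.pow_ne_top ENNReal.ofNat_ne_top) hK 0
  rw [mixedNorm_congr_ae hΩ h0 hd hww' hu.ae_eq_mk, mixedNorm_congr_ae hΩ h0 hd hww' hg.ae_eq_mk]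
  exact (hasTailBound_zero hΩ h0 p w' hu.ae_eq_mk hg.ae_eq_mk hp₀ hΛ H).mixedNorm_le hΩ hk hl hd
    hw' hu.measurable_mk hg.measurable_mk hp₀ hp hK hwA hN0 hN

end MixedExtrapolation

end

theorem theorem8p1_general {d m : ℕ} {p₀ : ℝ} (hp₀ : 1 < p₀) {p : Fin m → ℝ} (hp : ∀ i, 1 < p i)
    {k : Fin d → ℕ} (hk : ∀ j, 1 ≤ k j) (K₀ : ℝ) :
    ∃ Λ₀ : ℝ, 1 ≤ Λ₀ ∧ ∀ N₀ : ℝ, 0 < N₀ → ∃ N : ℝ, 0 < N ∧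
      ∀ (Ω : Fin d → Set ℝ), (∀ j, Ω j = Set.univ ∨ Ω j = Set.Ici 0) →
      ∀ (l : Fin (m + 1) → ℕ), Monotone l → l 0 = 0 → l (Fin.last m) = d →
      ∀ (w : (i : Fin m) → ((MixedExtrapolation.block (d := d) l i) → ℝ) → ℝ),
        (∀ i, MixedExtrapolation.IsApWeight (fun j : MixedExtrapolation.block l i => Ω j)
            (fun j => k j) (p i) (w i) ∧
          MixedExtrapolation.apConst (fun j : MixedExtrapolation.block l i => Ω j)
            (fun j => k j) (p i) (w i) ≤ ENNReal.ofReal K₀) →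
      ∀ (u g : (Fin d → ℝ) → ℝ),
        AEMeasurable u (volume.restrict (MixedExtrapolation.domain Ω)) →
        AEMeasurable g (volume.restrict (MixedExtrapolation.domain Ω)) →
        (∀ v : (Fin d → ℝ) → ℝ,
          MixedExtrapolation.IsApWeight Ω k p₀ v →
          MixedExtrapolation.apConst Ω k p₀ v ≤ ENNReal.ofReal Λ₀ →
          MixedExtrapolation.weightedNorm Ω p₀ v u ≤
            ENNReal.ofReal N₀ * MixedExtrapolation.weightedNorm Ω p₀ v g) →
        MixedExtrapolation.mixedNorm Ω l p w u ≤
          ENNReal.ofReal N * MixedExtrapolation.mixedNorm Ω l p w g := by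
  set Λ := MixedExtrapolation.tailConst (Fin.cons p₀ p) (4 ^ ∑ j, k j) (ENNReal.ofReal K₀) 0
  have hΛ : Λ ≠ ∞ := MixedExtrapolation.tailConst_ne_top (MixedExtrapolation.one_lt_cons hp₀ hp)
    (ENNReal.pow_ne_top ENNReal.ofNat_ne_top) ENNReal.ofReal_ne_top 0
  have hΛ₀ : Λ ≤ ENNReal.ofReal (max 1 Λ.toReal) :=
    (ENNReal.ofReal_toReal hΛ).ge.trans (ENNReal.ofReal_le_ofReal (le_max_right _ _))
  refine ⟨max 1 Λ.toReal, le_max_left _ _, fun N₀ hN₀ => ⟨4 ^ m * N₀, by positivity, ?_⟩⟩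
  intro Ω hΩ l hl h0 hd w hw u g hu hg H
  have hN : ENNReal.ofReal (4 ^ m * N₀) = 4 ^ m * ENNReal.ofReal N₀ := by
    rw [ENNReal.ofReal_mul (by positivity), ENNReal.ofReal_pow zero_le_four, ENNReal.ofReal_ofNat]
  rw [hN]
  exact MixedExtrapolation.mixedNorm_le_of_forall_weightedNorm_le hΩ hk hl h0 hd hp₀ hp
    ENNReal.ofReal_ne_top (fun i => (hw i).1) (fun i => (hw i).2) hu hg
    (ENNReal.ofReal_pos.2 hN₀).ne' ENNReal.ofReal_ne_top fun v hv hvΛ => H v hv (hvΛ.trans hΛ₀)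

theorem theorem8p1 (d m : ℕ) (hm : 0 < m)
    (p : Fin m → ℝ) (hp : ∀ i, 1 < p i)
    (k : Fin d → ℕ) (hk : ∀ j, 1 ≤ k j)
    (K₀ : ℝ) (hK₀ : 1 < K₀) :
    ∃ Λ₀ : ℝ, 1 ≤ Λ₀ ∧ ∀ N₀ : ℝ, 0 < N₀ → ∃ N : ℝ, 0 < N ∧
      ∀ (Ω : Fin d → Set ℝ), (∀ j, Ω j = Set.univ ∨ Ω j = Set.Ici 0) →
      ∀ (l : Fin (m + 1) → ℕ), StrictMono l → l 0 = 0 → l (Fin.last m) = d →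
      ∀ (w : (i : Fin m) → ((MixedExtrapolation.block (d := d) l i) → ℝ) → ℝ),
        (∀ i, MixedExtrapolation.IsApWeight (fun j : MixedExtrapolation.block l i => Ω j)
            (fun j => k j) (p i) (w i) ∧
          MixedExtrapolation.apConst (fun j : MixedExtrapolation.block l i => Ω j)
            (fun j => k j) (p i) (w i) ≤ ENNReal.ofReal K₀) →
      ∀ (u g : (Fin d → ℝ) → ℝ),
        AEMeasurable u (volume.restrict (MixedExtrapolation.domain Ω)) →
        AEMeasurable g (volume.restrict (MixedExtrapolation.domain Ω)) →
        (∀ v : (Fin d → ℝ) → ℝ,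
          MixedExtrapolation.IsApWeight Ω k (p ⟨0, hm⟩) v →
          MixedExtrapolation.apConst Ω k (p ⟨0, hm⟩) v ≤ ENNReal.ofReal Λ₀ →
          MixedExtrapolation.weightedNorm Ω (p ⟨0, hm⟩) v u ≤
            ENNReal.ofReal N₀ * MixedExtrapolation.weightedNorm Ω (p ⟨0, hm⟩) v g) →
        MixedExtrapolation.mixedNorm Ω l p w u ≤
          ENNReal.ofReal N * MixedExtrapolation.mixedNorm Ω l p w g := by
  obtain ⟨Λ₀, hΛ₀, h⟩ := theorem8p1_general (hp ⟨0, hm⟩) hp hk K₀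
  refine ⟨Λ₀, hΛ₀, fun N₀ hN₀ => ?_⟩
  obtain ⟨N, hN, h⟩ := h N₀ hN₀
  exact ⟨N, hN, fun Ω hΩ l hl => h Ω hΩ l hl.monotone⟩
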